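/- Consider the fading AWGN channel $Y = HX + Z$ with $Z \sim \mathcal{CN}(0,1)$ independent of the state, where the fading coefficient $H \in \mathbb{C}$ has $\mathrm{E}[|H|^2] = 1$, and where the channel state information at the transmitter (CSIT) is a random variable $S_T$, with values in a standard Borel space $\mathcal{S}_T$ and arbitrarily jointly distributed with $H$. Over $n$ channel uses the pairs $(H_i, S_{T,i})$ are i.i.d., the noise is i.i.d. and independent of them, the transmitter knows $S_T$ causally (the input $X_i$ is a function of the message and of $S_{T,1},\dots,S_{T,i}$), and the receiver sees $(Y_i, H_i)$, $i=1,\dots,n$, i.e., $S_R = H$. Let $P(\cdot) : \mathcal{S}_T \to [0,\infty)$ be a measurable power control policy with $\mathrm{E}[P(S_T)] \le P$. Define $$\mathrm{SNR}(h) = \frac{|h|^2 \left(\mathrm{E}\big[\sqrt{P(S_T)} \,\big|\, H=h\big]\right)^2}{1 + |h|^2\, \mathrm{Var}\big[\sqrt{P(S_T)} \,\big|\, H=h\big]} ,$$ where the variance is that of the conditional law of $\sqrt{P(S_T)}$ given $H=h$, and let $\log$ be the natural logarithm. Then $\mathrm{E}[\log(1+\mathrm{SNR}(H))]$ is finite and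 the following hold. 1. (Forward model GMI.) Consider adaptive symbols $A = [X(s_T) : s_T \in \mathcal{S}_T]$, independent of $(H,S_T,Z)$, with jointly circularly-symmetric complex Gaussian entries of variances $\mathrm{E}[|X(s_T)|^2] = P(s_T)$, where $X(S_T)$ is transmitted (and $X(\cdot)$ is jointly measurable), and auxiliary densities $$q(y|a,h) = \frac{1}{\pi \sigma^2(h)} \exp\left(-\frac{|y - g(h)\, \bar x(h)|^2}{\sigma^2(h)}\right), \qquad g(h) \in \mathbb{C},\ \sigma^2(h) > 0,$$ where for each $h$ the variable $\bar X(h)$ is a linear function $\sum_{s_T} w(s_T,h) X(s_T)$ of the entries of $A$, or a mean-square limit of finite sums of this form. For $s\ge 0$ let $$I_s(A;Y|H) = \int p(h)\, \mathrm{E}\left[\left.\log \frac{q(Y|A,h)^s}{\int p(a)\, q(Y|a,h)^s\, da} \,\right|\, H=h\right] dh .$$ Then the maximum of $I_s(A;Y|H)$ over all such $A$, $\bar X(\cdot)$, $g(\cdot)$, $\sigma^2(\cdot)$ and $s \ge 0$ for which the outer integral is well defined and finite exists and equals $\mathrm{E}[\log(1+\mathrm{SNR}(H))]$. 2. (Achievability.)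 The rate $R = \mathrm{E}[\log(1+\mathrm{SNR}(H))]$ (in nats per channel use) is achievable under the average power constraint $P$: for every $\varepsilon>0$ and all sufficiently large $n$ there is a length-$n$ code with causal CSIT and receiver side information $H^n$ that has at least $e^{n(R-\varepsilon)}$ messages, error probability at most $\varepsilon$ for uniformly distributed messages, and $\frac1n \sum_{i=1}^n \mathrm{E}[|X_i|^2] \le P$. -/

import Mathlib

open MeasureTheory ProbabilityTheory
open scoped NNReal ENNReal

noncomputable section

namespace FadingCSIT

/-! ### Circularly-symmetric complex Gaussian (CSCG) variables -/

/-- The law `𝒞𝒩(0, v)`: independent real and imaginary parts, each `𝒩(0, v / 2)`.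
For `v = 0` it is the unit mass at `0`. -/
def cscg (v : ℝ≥0) : Measure ℂ :=
  ((gaussianReal 0 (v / 2)).prod (gaussianReal 0 (v / 2))).map fun p => (⟨p.1, p.2⟩ : ℂ)

/-- A family of complex random variables is jointly CSCG if every finite complex linear
combination of its members is CSCG. -/
def IsJointlyCSCG {ι A : Type*} [MeasurableSpace A] (P : Measure A) (X : ι → A → ℂ) : Prop :=
  ∀ w : ι →₀ ℂ, ∃ v : ℝ≥0, P.map (fun a => w.sum fun i c => c * X i a) = cscg v

/-! ### Forward auxiliary models and their generalized mutual information -/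

/-- An adaptive symbol `A = [X(s) : s ∈ 𝒮]` with jointly CSCG entries of powers `E|X(s)|² = Pol s`,
together with a forward auxiliary model for a receiver that knows the fading coefficient `h`:
`Y = gain h * Xbar h + noise`, with noise `𝒞𝒩(0, noiseVar h)`, where `Xbar h` is a
linear function of the entries of `A`. -/
structure ForwardModel {𝒮 : Type*} [MeasurableSpace 𝒮] (Pol : 𝒮 → ℝ≥0) where
  /-- the alphabet of the adaptive symbol -/
  A : Type
  [measurableSpace : MeasurableSpace A]
  /-- the law of the adaptive symbol -/
  P : Measure A
  [isProbabilityMeasure : IsProbabilityMeasure P]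
  /-- `X s` is the channel input that is sent when the CSIT is `s` -/
  X : 𝒮 → A → ℂ
  measurable_X : Measurable (Function.uncurry X)
  jointlyCSCG : IsJointlyCSCG P X
  law_X : ∀ s, P.map (X s) = cscg (Pol s)
  /-- the auxiliary input -/
  Xbar : ℂ → A → ℂ
  measurable_Xbar : ∀ h, Measurable (Xbar h)
  /-- `Xbar h` is a weighted sum `∑ s, w s * X s`, or a mean-square limit of such sums when the
  CSIT alphabet is infinite. -/
  linear_Xbar : ∀ h : ℂ, ∀ ε : ℝ≥0∞, 0 < ε → ∃ w : 𝒮 →₀ ℂ,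
    eLpNorm (fun a => Xbar h a - w.sum fun s c => c * X s a) 2 P ≤ ε
  /-- the channel gain of the auxiliary model -/
  gain : ℂ → ℂ
  /-- the noise variance of the auxiliary model -/
  noiseVar : ℂ → ℝ
  noiseVar_pos : ∀ h, 0 < noiseVar h

attribute [instance] ForwardModel.measurableSpace ForwardModel.isProbabilityMeasure

namespace ForwardModel

variable {𝒮 : Type*} [MeasurableSpace 𝒮] {Pol : 𝒮 → ℝ≥0}

/-- The auxiliary channel density `q(y | a, h)`. -/
def q (F : ForwardModel Pol) (h y : ℂ) (a : F.A) : ℝ :=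
  1 / (Real.pi * F.noiseVar h) * Real.exp (-(‖y - F.gain h * F.Xbar h a‖ ^ 2 / F.noiseVar h))

/-- `q(y | h) = ∫ p(a) q(y | a, h) ^ t da`. -/
def qOut (F : ForwardModel Pol) (t : ℝ) (h y : ℂ) : ℝ :=
  ∫ a, F.q h y a ^ t ∂F.P

/-- `I_t(A; Y | H = h) = E[log (q(Y | A, h) ^ t / q(Y | h)) | H = h]`. Under the true law given
`H = h`, the variables `A`, `S_T ∼ κ h`, `Z ∼ 𝒞𝒩(0, 1)` are independent, and
`Y = h * X(S_T) + Z`. -/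
def gmiAt (F : ForwardModel Pol) (κ : Kernel ℂ 𝒮) (t : ℝ) (h : ℂ) : ℝ :=
  ∫ p : F.A × 𝒮 × ℂ,
    Real.log (F.q h (h * F.X p.2.1 p.1 + p.2.2) p.1 ^ t /
      F.qOut t h (h * F.X p.2.1 p.1 + p.2.2))
    ∂(F.P.prod ((κ h).prod (cscg 1)))

end ForwardModel

/-- The values `I_t(A; Y | H) = ∫ p(h) I_t(A; Y | H = h) dh`, `t ≥ 0`, for all forward models
with power policy `Pol`; `PH` is the law of `H` and `κ h` the law of `S_T` given `H = h`. -/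
def forwardGMIs {𝒮 : Type*} [MeasurableSpace 𝒮] (PH : Measure ℂ) (κ : Kernel ℂ 𝒮)
    (Pol : 𝒮 → ℝ≥0) : Set ℝ :=
  {r | ∃ (F : ForwardModel Pol) (t : ℝ), 0 ≤ t ∧
    Integrable (F.gmiAt κ t) PH ∧ r = ∫ h, F.gmiAt κ t h ∂PH}

/-- `SNR(h) = |h|² (E[√P(S_T) | H = h])² / (1 + |h|² Var[√P(S_T) | H = h])`. -/
def snr {𝒮 : Type*} [MeasurableSpace 𝒮] (κ : Kernel ℂ 𝒮) (Pol : 𝒮 → ℝ≥0) (h : ℂ) : ℝ :=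
  ‖h‖ ^ 2 * (∫ s, √(Pol s : ℝ) ∂κ h) ^ 2 /
    (1 + ‖h‖ ^ 2 * variance (fun s => √(Pol s : ℝ)) (κ h))

/-! ### Codes with causal CSIT and full CSIR -/

/-- A block code of length `n` with `M` messages. The input at time `i` is a function of the
message and of the CSIT up to time `i`; the receiver observes the pairs `(Y_i, H_i)`. -/
structure Code (𝒮 : Type*) [MeasurableSpace 𝒮] (n M : ℕ) where
  enc : (i : Fin n) → Fin M → ({j : Fin n // j ≤ i} → 𝒮) → ℂ
  measurable_enc : ∀ i m, Measurable (enc i m)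
  dec : (Fin n → ℂ × ℂ) → Fin M
  measurable_dec : Measurable dec

namespace Code

variable {𝒮 : Type*} [MeasurableSpace 𝒮] {n M : ℕ}

/-- The input `X_i` for message `m` when the states are `σ_j = (H_j, S_{T,j})`. -/
def input (C : Code 𝒮 n M) (m : Fin M) (σ : Fin n → ℂ × 𝒮) (i : Fin n) : ℂ :=
  C.enc i m fun j => (σ j).2

/-- What the receiver observes: `(Y_i, H_i)` with `Y_i = H_i X_i + Z_i`. -/
def received (C : Code 𝒮 n M) (m : Fin M) (σ : Fin n → ℂ × 𝒮) (z : Fin n → ℂ) :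
    Fin n → ℂ × ℂ :=
  fun i => ((σ i).1 * C.input m σ i + z i, (σ i).1)

/-- The probability that a uniformly distributed message is decoded incorrectly, for i.i.d. states
`(H_i, S_{T,i})` of law `ν` and independent i.i.d. noise `Z_i ∼ 𝒞𝒩(0, 1)`. -/
def errorProb (C : Code 𝒮 n M) (ν : Measure (ℂ × 𝒮)) : ℝ :=
  (∑ m : Fin M, ((Measure.pi fun _ : Fin n => ν).prod (Measure.pi fun _ : Fin n => cscg 1)).real
    {p | C.dec (C.received m p.1 p.2) ≠ m}) / M

/-- The average power `(1 / n) ∑ i, E|X_i|²` for a uniformly distributed message. -/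
def avgPower (C : Code 𝒮 n M) (ν : Measure (ℂ × 𝒮)) : ℝ≥0∞ :=
  (∑ m : Fin M, ∑ i : Fin n,
    ∫⁻ σ, ‖C.input m σ i‖ₑ ^ 2 ∂(Measure.pi fun _ : Fin n => ν)) / (M * n)

end Code

/-- `R` (in nats per channel use) is achievable under the average power constraint `Pmax` on the
fading channel whose states `(H, S_T)` have joint law `ν`. -/
def IsAchievableRate {𝒮 : Type*} [MeasurableSpace 𝒮] (ν : Measure (ℂ × 𝒮)) (Pmax : ℝ≥0)
    (R : ℝ) : Prop :=
  ∀ ε : ℝ, 0 < ε → ∃ N : ℕ, ∀ n : ℕ, N ≤ n → ∃ (M : ℕ) (C : Code 𝒮 n M),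
    Real.exp (n * (R - ε)) ≤ M ∧ C.errorProb ν ≤ ε ∧ C.avgPower ν ≤ Pmax

end FadingCSIT

end

/-!
For a forward model with signal part `U` of power `v` and tilted noise variance `b`, the GMI given
`H = h` equals `log (1 + v / b) + E|Y|² / (b + v) - E|Y - U|² / b`. It therefore depends on the
symbol only through the correlation `Re E[Y conj(U)]`, which the Cauchy–Schwarz inequality bounds
by `|h| E[√P(S_T) | H = h] √v`. Equality holds for a fully correlated symbol `X(s) = √P(s) W`, and
the maximum over `v` and `b` is then attained at the linear minimum mean-square error model.

For achievability, adaptive codewords are drawn i.i.d. from the optimal symbol and decoded with a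
threshold on the information density, whose mean is the maximal GMI. For an independent codeword
the information density has exponential moment one, so that Markov's inequality controls wrong
messages. The power policy is first scaled by a factor `c < 1`, which costs at most the factor `c`
in rate, so that a single codebook meets both the power and the error constraint.
-/

noncomputable section

namespace FadingCSIT

instance isProbabilityMeasure_cscg (v : ℝ≥0) : IsProbabilityMeasure (cscg v) :=
  Measure.isProbabilityMeasure_map Complex.measurableEquivRealProd.symm.measurable.aemeasurable

lemma measurableEmbedding_complex_mk : MeasurableEmbedding fun p : ℝ × ℝ => (⟨p.1, p.2⟩ : ℂ) :=
  Complex.measurableEquivRealProd.symm.measurableEmbedding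

lemma integral_cscg {E : Type*} [NormedAddCommGroup E] [NormedSpace ℝ E] (v : ℝ≥0) (f : ℂ → E) :
    ∫ z, f z ∂cscg v = ∫ p : ℝ × ℝ, f ⟨p.1, p.2⟩
      ∂((gaussianReal 0 (v / 2)).prod (gaussianReal 0 (v / 2))) :=
  measurableEmbedding_complex_mk.integral_map f

lemma integrable_cscg_iff {E : Type*} [NormedAddCommGroup E] {v : ℝ≥0} {f : ℂ → E} :
    Integrable f (cscg v) ↔ Integrable (fun p : ℝ × ℝ => f ⟨p.1, p.2⟩)
      ((gaussianReal 0 (v / 2)).prod (gaussianReal 0 (v / 2))) :=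
  measurableEmbedding_complex_mk.integrable_map_iff

lemma norm_complex_sq (z : ℂ) : ‖z‖ ^ 2 = z.re ^ 2 + z.im ^ 2 := by
  rw [Complex.sq_norm, Complex.normSq_apply]
  ring

lemma integrable_sq_gaussianReal (m : ℝ) (v : ℝ≥0) :
    Integrable (fun x : ℝ => x ^ 2) (gaussianReal m v) :=
  (memLp_id_gaussianReal' 2 (by simp)).integrable_sq

lemma integral_sq_gaussianReal_zero (v : ℝ≥0) : ∫ x, x ^ 2 ∂gaussianReal 0 v = v := by
  have h := variance_fun_id_gaussianReal (μ := 0) (v := v)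
  rw [variance_eq_integral (by fun_prop), integral_id_gaussianReal] at h
  simpa using h

lemma memLp_two_id_cscg (v : ℝ≥0) : MemLp id 2 (cscg v) := by
  rw [memLp_two_iff_integrable_sq_norm (by fun_prop), integrable_cscg_iff]
  simp only [id, norm_complex_sq]
  exact ((integrable_sq_gaussianReal 0 _).comp_fst _).add
    ((integrable_sq_gaussianReal 0 _).comp_snd _)

lemma integral_norm_sq_cscg (v : ℝ≥0) : ∫ z, ‖z‖ ^ 2 ∂cscg v = v := by
  have hsq := integrable_sq_gaussianReal 0 (v / 2)
  simp only [integral_cscg, norm_complex_sq]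
  rw [integral_add (hsq.comp_fst _) (hsq.comp_snd _),
    integral_fun_fst (f := fun x : ℝ => x ^ 2), integral_fun_snd (f := fun x : ℝ => x ^ 2),
    integral_sq_gaussianReal_zero]
  simp

lemma lintegral_enorm_sq_cscg (v : ℝ≥0) : ∫⁻ z, ‖z‖ₑ ^ 2 ∂cscg v = v := by
  have h := ofReal_integral_eq_lintegral_ofReal (memLp_two_id_cscg v).integrable_norm_pow'
    (ae_of_all _ fun z => by positivity)
  simpa [integral_norm_sq_cscg, ENNReal.ofReal_pow] using h.symm

lemma integral_id_cscg (v : ℝ≥0) : ∫ z, z ∂cscg v = 0 := by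
  have hint := integrable_cscg_iff.1 ((memLp_two_id_cscg v).integrable one_le_two)
  rw [integral_cscg]
  apply Complex.ext
  · have hre := integral_re hint
    simp only [id, RCLike.re_eq_complex_re] at hre
    rw [← hre, integral_fun_fst (f := fun x : ℝ => x), integral_id_gaussianReal]
    simp
  · have him := integral_im hint
    simp only [id, RCLike.im_eq_complex_im] at him
    rw [← him, integral_fun_snd (f := fun x : ℝ => x), integral_id_gaussianReal]
    simp

lemma charFun_cscg (v : ℝ≥0) (t : ℂ) :
    charFun (cscg v) t = Complex.exp (-(v * ‖t‖ ^ 2 / 4)) := by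
  have hinner (p : ℝ × ℝ) : Complex.exp (inner ℝ (⟨p.1, p.2⟩ : ℂ) t * Complex.I) =
      Complex.exp (t.re * p.1 * Complex.I) * Complex.exp (t.im * p.2 * Complex.I) := by
    rw [← Complex.exp_add]
    congr 1
    simp [Complex.inner]
    ring
  have hcoord (s : ℝ) : ∫ x : ℝ, Complex.exp (s * x * Complex.I) ∂gaussianReal 0 (v / 2) =
      Complex.exp (-(v * s ^ 2 / 4)) := by
    rw [← charFun_apply_real, charFun_gaussianReal]
    congr 1
    push_cast
    ring
  simp_rw [charFun_apply, integral_cscg, hinner]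
  rw [integral_prod_mul (fun x : ℝ => Complex.exp (t.re * x * Complex.I))
    (fun x : ℝ => Complex.exp (t.im * x * Complex.I)), hcoord, hcoord, ← Complex.exp_add,
    ← Complex.ofReal_pow ‖t‖, norm_complex_sq]
  congr 1
  push_cast
  ring

lemma map_const_mul_cscg (v : ℝ≥0) (c : ℂ) :
    (cscg v).map (fun z => c * z) = cscg (‖c‖₊ ^ 2 * v) := by
  have : IsProbabilityMeasure ((cscg v).map (fun z => c * z)) :=
    Measure.isProbabilityMeasure_map (by fun_prop)
  have hinner (t z : ℂ) : inner ℝ (c * z) t = inner ℝ z (starRingEnd ℂ c * t) := by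
    simp [Complex.inner]
    ring
  refine Measure.ext_of_charFun (funext fun t => ?_)
  rw [charFun_apply, integral_map (by fun_prop) (by fun_prop)]
  simp_rw [hinner]
  rw [← charFun_apply, charFun_cscg, charFun_cscg]
  simp only [norm_mul, RCLike.norm_conj, NNReal.coe_mul, NNReal.coe_pow, coe_nnnorm]
  congr 1
  push_cast
  ring

/-- The density at `y` of a circularly-symmetric complex Gaussian variable of mean `u` and
variance `b`, as used by the auxiliary channel `ForwardModel.q`. -/
def cscgPDF (b : ℝ) (u y : ℂ) : ℝ :=
  1 / (Real.pi * b) * Real.exp (-(‖y - u‖ ^ 2 / b))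

lemma cscgPDF_pos {b : ℝ} (hb : 0 < b) (u y : ℂ) : 0 < cscgPDF b u y := by
  unfold cscgPDF
  positivity

lemma cscgPDF_eq_mul_gaussianPDFReal (b : ℝ≥0) (u y : ℂ) :
    cscgPDF b u y =
      gaussianPDFReal u.re (b / 2) y.re * gaussianPDFReal u.im (b / 2) y.im := by
  have hsqrt : (√(Real.pi * b))⁻¹ * (√(Real.pi * b))⁻¹ = 1 / (Real.pi * b) := by
    rw [← mul_inv, Real.mul_self_sqrt (by positivity), one_div]
  have htwo : 2 * Real.pi * ((b : ℝ) / 2) = Real.pi * b := by ring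
  simp only [gaussianPDFReal, cscgPDF, NNReal.coe_div, NNReal.coe_ofNat, htwo]
  rw [mul_mul_mul_comm, hsqrt, ← Real.exp_add, norm_complex_sq, Complex.sub_re, Complex.sub_im]
  congr 2
  ring

lemma gaussianPDFReal_mul_gaussianPDFReal {v w : ℝ≥0} (hv : v ≠ 0) (hw : w ≠ 0) (x y : ℝ) :
    gaussianPDFReal 0 v x * gaussianPDFReal x w y =
      gaussianPDFReal 0 (v + w) y * gaussianPDFReal (v / (v + w) * y) (v * w / (v + w)) x := by
  have hsqrt : (√(2 * Real.pi * v))⁻¹ * (√(2 * Real.pi * w))⁻¹ =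
      (√(2 * Real.pi * (v + w)))⁻¹ * (√(2 * Real.pi * (v * w / (v + w))))⁻¹ := by
    rw [← mul_inv, ← mul_inv, ← Real.sqrt_mul (by positivity), ← Real.sqrt_mul (by positivity)]
    congr 2
    field_simp
  simp only [gaussianPDFReal, NNReal.coe_add, NNReal.coe_mul, NNReal.coe_div]
  rw [mul_mul_mul_comm, hsqrt, ← Real.exp_add, mul_mul_mul_comm, ← Real.exp_add]
  congr 2
  field_simp
  ring

lemma integral_gaussianPDFReal_gaussianReal (v : ℝ≥0) {w : ℝ≥0} (hw : w ≠ 0) (y : ℝ) :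
    ∫ x, gaussianPDFReal x w y ∂gaussianReal 0 v = gaussianPDFReal 0 (v + w) y := by
  rcases eq_or_ne v 0 with rfl | hv
  · simp
  · simp_rw [integral_gaussianReal_eq_integral_smul hv, smul_eq_mul,
      gaussianPDFReal_mul_gaussianPDFReal hv hw]
    rw [integral_const_mul, integral_gaussianPDFReal_eq_one _ (by positivity), mul_one]

lemma integral_cscgPDF {b : ℝ} (hb : 0 < b) (v : ℝ≥0) (y : ℂ) :
    ∫ u, cscgPDF b u y ∂cscg v = cscgPDF (b + v) 0 y := by
  lift b to ℝ≥0 using hb.le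
  have hb2 : b / 2 ≠ 0 := by
    have : 0 < b := hb
    positivity
  rw [integral_cscg, ← NNReal.coe_add]
  simp_rw [cscgPDF_eq_mul_gaussianPDFReal]
  rw [integral_prod_mul (fun x => gaussianPDFReal x (b / 2) y.re)
    (fun x => gaussianPDFReal x (b / 2) y.im), integral_gaussianPDFReal_gaussianReal _ hb2,
    integral_gaussianPDFReal_gaussianReal _ hb2, ← add_div, add_comm v]
  rfl

lemma log_cscgPDF_div_cscgPDF {b V : ℝ} (hb : 0 < b) (hV : 0 ≤ V) (u y : ℂ) :
    Real.log (cscgPDF b u y / cscgPDF (b + V) 0 y) =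
      Real.log (1 + V / b) + (‖y‖ ^ 2 / (b + V) - ‖y - u‖ ^ 2 / b) := by
  have hratio : cscgPDF b u y / cscgPDF (b + V) 0 y =
      (1 + V / b) * Real.exp (‖y‖ ^ 2 / (b + V) - ‖y - u‖ ^ 2 / b) := by
    rw [Real.exp_sub, cscgPDF, cscgPDF, Real.exp_neg, Real.exp_neg, sub_zero]
    field_simp
  rw [hratio, Real.log_mul (by positivity) (by positivity), Real.log_exp]

section SecondMoment

variable {A E : Type*} [MeasurableSpace A] {P : Measure A} [NormedAddCommGroup E]

lemma lpNorm_two_sq {f : A → E} (hf : AEStronglyMeasurable f P) :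
    lpNorm f 2 P ^ 2 = ∫ a, ‖f a‖ ^ 2 ∂P := by
  have hnn : 0 ≤ ∫ a, ‖f a‖ ^ 2 ∂P := integral_nonneg fun a => by positivity
  rw [lpNorm_eq_integral_norm_rpow_toReal two_ne_zero ENNReal.ofNat_ne_top hf]
  simp only [ENNReal.toReal_ofNat, Real.rpow_ofNat]
  rw [← one_div, ← Real.sqrt_eq_rpow, Real.sq_sqrt hnn]

variable {U : A → ℂ} {v : ℝ≥0}

lemma memLp_two_of_hasLaw_cscg (hU : HasLaw U (cscg v) P) : MemLp U 2 P :=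
  (memLp_map_measure_iff (g := id) (by fun_prop) hU.aemeasurable).1
    (hU.map_eq ▸ memLp_two_id_cscg v)

lemma integral_norm_sq_of_hasLaw_cscg (hU : HasLaw U (cscg v) P) : ∫ a, ‖U a‖ ^ 2 ∂P = v :=
  (hU.integral_comp (f := fun z : ℂ => ‖z‖ ^ 2) (by fun_prop)).trans (integral_norm_sq_cscg v)

lemma integral_of_hasLaw_cscg (hU : HasLaw U (cscg v) P) : ∫ a, U a ∂P = 0 :=
  (hU.integral_comp (f := id) (by fun_prop)).trans (integral_id_cscg v)

lemma hasLaw_const_mul_cscg (hU : HasLaw U (cscg v) P) (c : ℂ) :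
    HasLaw (fun a => c * U a) (cscg (‖c‖₊ ^ 2 * v)) P :=
  HasLaw.fun_comp (Y := fun z => c * z) ⟨by fun_prop, map_const_mul_cscg v c⟩ hU

variable [IsProbabilityMeasure P]

/- The variances converge because the `L²` norms do; hence so do the characteristic functions,
and their limit is that of a CSCG law. -/
lemma exists_hasLaw_cscg_of_tendsto {S : ℕ → A → ℂ} {w : ℕ → ℝ≥0}
    (hS : ∀ n, HasLaw (S n) (cscg (w n)) P) (hU : MemLp U 2 P)
    (hlim : Filter.Tendsto (fun n => eLpNorm (S n - U) 2 P) Filter.atTop (nhds 0)) :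
    ∃ v, HasLaw U (cscg v) P := by
  have hSL (n : ℕ) : MemLp (S n) 2 P := memLp_two_of_hasLaw_cscg (hS n)
  have hlp : Filter.Tendsto (fun n => lpNorm (S n) 2 P) Filter.atTop (nhds (lpNorm U 2 P)) := by
    have hsub : Filter.Tendsto (fun n => lpNorm (S n - U) 2 P) Filter.atTop (nhds 0) := by
      simpa [Function.comp_def, toReal_eLpNorm ((hSL _).sub hU).1] using
        (ENNReal.tendsto_toReal ENNReal.zero_ne_top).comp hlim
    refine tendsto_iff_dist_tendsto_zero.2 (squeeze_zero (fun _ => dist_nonneg) (fun n => ?_) hsub)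
    rw [Real.dist_eq, abs_sub_le_iff]
    have h1 := lpNorm_le_lpNorm_add_lpNorm_sub' (f := S n) hU one_le_two
    have h2 := lpNorm_le_lpNorm_add_lpNorm_sub (f := U) (hSL n) one_le_two
    constructor <;> linarith
  have hvar : Filter.Tendsto (fun n => (w n : ℝ)) Filter.atTop (nhds (lpNorm U 2 P ^ 2)) := by
    refine (hlp.pow 2).congr fun n => ?_
    rw [lpNorm_two_sq (hSL n).1, integral_norm_sq_of_hasLaw_cscg (hS n)]
  have hdist := (tendstoInMeasure_of_tendsto_eLpNorm two_ne_zero (fun n => (hSL n).1) hU.1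
    hlim).tendstoInDistribution fun n => (hS n).aemeasurable
  have : IsProbabilityMeasure (P.map U) := Measure.isProbabilityMeasure_map hU.1.aemeasurable
  refine ⟨(lpNorm U 2 P ^ 2).toNNReal, hU.1.aemeasurable,
    Measure.ext_of_charFun (funext fun t => ?_)⟩
  refine tendsto_nhds_unique (ProbabilityMeasure.tendsto_iff_tendsto_charFun.1 hdist.tendsto t) ?_
  simp only [ProbabilityMeasure.coe_mk, (hS _).map_eq, charFun_cscg,
    Real.coe_toNNReal _ (sq_nonneg (lpNorm U 2 P))]
  have hcont : Continuous fun x : ℝ => Complex.exp (-(x * ‖t‖ ^ 2 / 4)) := by fun_prop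
  exact (hcont.tendsto _).comp hvar

lemma exists_hasLaw_cscg_of_forall_approx (hU : AEStronglyMeasurable U P)
    (happrox : ∀ ε : ℝ≥0∞, 0 < ε →
      ∃ S : A → ℂ, (∃ w, HasLaw S (cscg w) P) ∧ eLpNorm (U - S) 2 P ≤ ε) :
    ∃ v, HasLaw U (cscg v) P := by
  obtain ⟨ε, -, hε, hεlim⟩ := exists_seq_strictAnti_tendsto' (zero_lt_one' ℝ≥0∞)
  choose S hS hSU using fun n => happrox (ε n) (hε n).1
  choose w hw using hS
  have hUL : MemLp U 2 P := by
    have hSL := memLp_two_of_hasLaw_cscg (hw 0)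
    have hdiff : MemLp (U - S 0) 2 P :=
      ⟨hU.sub hSL.1, (hSU 0).trans_lt ((hε 0).2.trans ENNReal.one_lt_top)⟩
    simpa using hdiff.add hSL
  refine exists_hasLaw_cscg_of_tendsto hw hUL ?_
  refine tendsto_of_tendsto_of_tendsto_of_le_of_le tendsto_const_nhds hεlim (fun _ => zero_le)
    fun n => ?_
  simpa only [eLpNorm_sub_comm] using hSU n

end SecondMoment

section SquareIntegrable

variable {A E : Type*} [MeasurableSpace A] {P : Measure A} [NormedAddCommGroup E]
  [InnerProductSpace ℝ E] {Y U : A → E}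

lemma integrable_inner_of_memLp_two (hY : MemLp Y 2 P) (hU : MemLp U 2 P) :
    Integrable (fun a => inner ℝ (Y a) (U a)) P := by
  refine (hY.norm.integrable_mul hU.norm).mono (hY.1.inner hU.1) (ae_of_all _ fun a => ?_)
  simpa using abs_real_inner_le_norm (Y a) (U a)

lemma integral_inner_le_sqrt_mul_sqrt (hY : MemLp Y 2 P) (hU : MemLp U 2 P) :
    ∫ a, inner ℝ (Y a) (U a) ∂P ≤ √(∫ a, ‖Y a‖ ^ 2 ∂P) * √(∫ a, ‖U a‖ ^ 2 ∂P) := by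
  have hHolder := integral_mul_norm_le_Lp_mul_Lq (p := 2) (q := 2) (μ := P) (f := Y) (g := U)
    (by rw [Real.holderConjugate_iff]; norm_num) (by simpa using hY) (by simpa using hU)
  simp only [Real.rpow_ofNat, ← Real.sqrt_eq_rpow] at hHolder
  exact (integral_mono (integrable_inner_of_memLp_two hY hU) (hY.norm.integrable_mul hU.norm)
    fun a => real_inner_le_norm _ _).trans hHolder

lemma integral_norm_sub_sq (hY : MemLp Y 2 P) (hU : MemLp U 2 P) :
    ∫ a, ‖Y a - U a‖ ^ 2 ∂P =
      ∫ a, ‖Y a‖ ^ 2 ∂P - 2 * ∫ a, inner ℝ (Y a) (U a) ∂P + ∫ a, ‖U a‖ ^ 2 ∂P := by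
  have hY2 := hY.integrable_norm_pow two_ne_zero
  have hYU := (integrable_inner_of_memLp_two hY hU).const_mul 2
  have hdiff : Integrable (fun a => ‖Y a‖ ^ 2 - 2 * inner ℝ (Y a) (U a)) P := hY2.sub hYU
  simp_rw [norm_sub_sq_real]
  rw [integral_add hdiff (hU.integrable_norm_pow two_ne_zero), integral_sub hY2 hYU,
    integral_const_mul]

variable [IsProbabilityMeasure P] [CompleteSpace E]

lemma integral_inner_add_const (hY : MemLp Y 2 P) (hU : MemLp U 2 P) (hU0 : ∫ a, U a ∂P = 0)
    (z : E) : ∫ a, inner ℝ (Y a + z) (U a) ∂P = ∫ a, inner ℝ (Y a) (U a) ∂P := by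
  have hUi := hU.integrable one_le_two
  simp_rw [inner_add_left]
  rw [integral_add (integrable_inner_of_memLp_two hY hU) (hUi.const_inner z),
    integral_inner hUi, hU0, inner_zero_right, add_zero]

lemma integral_norm_add_const_sq (hY : MemLp Y 2 P) (hY0 : ∫ a, Y a ∂P = 0) (z : E) :
    ∫ a, ‖Y a + z‖ ^ 2 ∂P = ∫ a, ‖Y a‖ ^ 2 ∂P + ‖z‖ ^ 2 := by
  have hsub := integral_norm_sub_sq hY (memLp_const (-z))
  simp only [sub_neg_eq_add, norm_neg] at hsub
  simp_rw [hsub, real_inner_comm (-z)]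
  rw [integral_inner (hY.integrable one_le_two), hY0]
  simp

end SquareIntegrable

lemma integrable_coe_of_lintegral_le {α : Type*} [MeasurableSpace α] {P : Measure α} {f : α → ℝ≥0}
    (hf : Measurable f) {c : ℝ≥0} (hle : ∫⁻ x, f x ∂P ≤ c) : Integrable (fun x => (f x : ℝ)) P := by
  refine ⟨(by fun_prop : Measurable fun x => (f x : ℝ)).aestronglyMeasurable, ?_⟩
  rw [hasFiniteIntegral_iff_ofReal (.of_forall fun _ => NNReal.coe_nonneg _)]
  simp only [ENNReal.ofReal_coe_nnreal]
  exact hle.trans_lt ENNReal.coe_lt_top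

lemma integrable_log_one_add {Ω : Type*} [MeasurableSpace Ω] {μ : Measure Ω} {f : Ω → ℝ}
    (hf : Integrable f μ) (hf0 : ∀ ω, 0 ≤ f ω) : Integrable (fun ω => Real.log (1 + f ω)) μ := by
  refine hf.mono' (Real.measurable_log.comp_aemeasurable
    (hf.1.aemeasurable.const_add 1)).aestronglyMeasurable (.of_forall fun ω => ?_)
  rw [Real.norm_of_nonneg (Real.log_nonneg (le_add_of_nonneg_right (hf0 ω)))]
  linarith [Real.log_le_sub_one_of_pos (add_pos_of_pos_of_nonneg one_pos (hf0 ω))]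

lemma mul_log_one_add_le_log_one_add_mul {c x : ℝ} (hc0 : 0 ≤ c) (hc1 : c ≤ 1) (hx : 0 ≤ x) :
    c * Real.log (1 + x) ≤ Real.log (1 + c * x) := by
  rw [← Real.log_rpow (by positivity)]
  refine Real.log_le_log (by positivity) ?_
  exact rpow_one_add_le_one_add_mul_self (by linarith) hc0 hc1

section SNR

variable {𝒮 : Type*} [MeasurableSpace 𝒮] (κ : Kernel ℂ 𝒮) (Pol : 𝒮 → ℝ≥0) (h : ℂ)

/-- `E[√P(S_T) | H = h]`. -/
def sqrtMean : ℝ := ∫ s, √(Pol s : ℝ) ∂κ h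

/-- `1 + |h|² Var[√P(S_T) | H = h]`, the denominator of `snr`. -/
def residualPower : ℝ :=
  1 + ‖h‖ ^ 2 * variance (fun s => √(Pol s : ℝ)) (κ h)

lemma one_le_residualPower : 1 ≤ residualPower κ Pol h :=
  le_add_of_nonneg_right (mul_nonneg (sq_nonneg _) (variance_nonneg _ _))

lemma residualPower_pos : 0 < residualPower κ Pol h :=
  one_pos.trans_le (one_le_residualPower κ Pol h)

lemma snr_eq_div_residualPower :
    snr κ Pol h = (‖h‖ * sqrtMean κ Pol h) ^ 2 / residualPower κ Pol h := by
  rw [snr, residualPower, sqrtMean, mul_pow]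

lemma snr_nonneg : 0 ≤ snr κ Pol h := by
  rw [snr_eq_div_residualPower]
  exact div_nonneg (sq_nonneg _) (residualPower_pos κ Pol h).le

lemma log_one_add_snr_nonneg : 0 ≤ Real.log (1 + snr κ Pol h) :=
  Real.log_nonneg (le_add_of_nonneg_right (snr_nonneg κ Pol h))

variable {κ Pol h}

lemma memLp_two_sqrt {ρ : Measure 𝒮} (hint : Integrable (fun s => (Pol s : ℝ)) ρ) :
    MemLp (fun s => √(Pol s : ℝ)) 2 ρ := by
  rw [memLp_two_iff_integrable_sq (Real.continuous_sqrt.comp_aestronglyMeasurable hint.1)]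
  simpa using hint

lemma residualPower_add_sq [IsMarkovKernel κ]
    (hint : Integrable (fun s => (Pol s : ℝ)) (κ h)) :
    residualPower κ Pol h + (‖h‖ * sqrtMean κ Pol h) ^ 2 =
      1 + ‖h‖ ^ 2 * ∫ s, (Pol s : ℝ) ∂κ h := by
  rw [residualPower, variance_eq_sub (memLp_two_sqrt hint), sqrtMean]
  simp only [Pi.pow_apply, Real.sq_sqrt NNReal.zero_le_coe]
  ring

lemma measurable_sqrtMean (hPol : Measurable Pol) : Measurable (sqrtMean κ Pol) := by
  have hsqrt : Measurable fun s => √(Pol s : ℝ) := by fun_prop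
  exact (StronglyMeasurable.integral_kernel (κ := κ) hsqrt.stronglyMeasurable).measurable

variable [IsSFiniteKernel κ]

lemma measurable_residualPower (hPol : Measurable Pol) : Measurable (residualPower κ Pol) := by
  have hmean := measurable_sqrtMean (κ := κ) hPol
  have hdev : Measurable fun p : ℂ × 𝒮 => ‖√(Pol p.2 : ℝ) - sqrtMean κ Pol p.1‖ₑ ^ 2 := by
    fun_prop
  have hvar : Measurable fun h => variance (fun s => √(Pol s : ℝ)) (κ h) :=
    (Measurable.lintegral_kernel_prod_right hdev).ennreal_toReal
  unfold residualPower
  fun_prop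

lemma measurable_snr (hPol : Measurable Pol) : Measurable (snr κ Pol) := by
  have hmean := measurable_sqrtMean (κ := κ) hPol
  have hres := measurable_residualPower (κ := κ) hPol
  rw [funext (snr_eq_div_residualPower κ Pol)]
  fun_prop

end SNR

section Models

variable {𝒮 : Type*} [MeasurableSpace 𝒮] {Pol : 𝒮 → ℝ≥0}

namespace ForwardModel

variable (F : ForwardModel Pol)

/-- The signal part `gain h * Xbar h` of the auxiliary model. -/
def signal (h : ℂ) (a : F.A) : ℂ := F.gain h * F.Xbar h a

/-- The second moment of `ForwardModel.signal`, in `ℝ≥0` so as to be a variance parameter of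
`cscg`. -/
def signalPower (h : ℂ) : ℝ≥0 := (∫ a, ‖F.signal h a‖ ^ 2 ∂F.P).toNNReal

/-- The law of `(A, S_T, Z)` when `S_T ∼ ρ`. -/
def law (ρ : Measure 𝒮) : Measure (F.A × 𝒮 × ℂ) := F.P.prod (ρ.prod (cscg 1))

/-- The channel output `Y = h X(S_T) + Z` as a function of `(A, S_T, Z)`. -/
def output (h : ℂ) (p : F.A × 𝒮 × ℂ) : ℂ := h * F.X p.2.1 p.1 + p.2.2

/-- The information density `log (q(y | a, h) ^ t / q(y | h))` of the symbol `a` and the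
observation `(y, h)`. -/
def infoDensity (t : ℝ) (a : F.A) (o : ℂ × ℂ) : ℝ :=
  Real.log (F.q o.2 o.1 a ^ t / F.qOut t o.2 o.1)

lemma gmiAt_eq_integral_law (κ : Kernel ℂ 𝒮) (t : ℝ) (h : ℂ) :
    F.gmiAt κ t h = ∫ p, F.infoDensity t p.1 (F.output h p, h) ∂F.law (κ h) := rfl

lemma hasLaw_X (s : 𝒮) : HasLaw (F.X s) (cscg (Pol s)) F.P :=
  ⟨(F.measurable_X.comp measurable_prodMk_left).aemeasurable, F.law_X s⟩

lemma lintegral_enorm_sq_X (s : 𝒮) : ∫⁻ a, ‖F.X s a‖ₑ ^ 2 ∂F.P = Pol s :=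
  ((F.hasLaw_X s).lintegral_comp (f := fun z : ℂ => ‖z‖ₑ ^ 2) (by fun_prop)).trans
    (lintegral_enorm_sq_cscg _)

lemma exists_hasLaw_sum_X (w : 𝒮 →₀ ℂ) :
    ∃ v, HasLaw (fun a => w.sum fun s c => c * F.X s a) (cscg v) F.P := by
  obtain ⟨v, hv⟩ := F.jointlyCSCG w
  refine ⟨v, (Finset.measurable_sum _ fun s _ => ?_).aemeasurable, hv⟩
  exact (F.measurable_X.comp measurable_prodMk_left).const_mul _

lemma hasLaw_signal (h : ℂ) : HasLaw (F.signal h) (cscg (F.signalPower h)) F.P := by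
  obtain ⟨v, hv⟩ := exists_hasLaw_cscg_of_forall_approx
    (F.measurable_Xbar h).aestronglyMeasurable fun ε hε => by
      obtain ⟨w, hw⟩ := F.linear_Xbar h ε hε
      exact ⟨_, F.exists_hasLaw_sum_X w, hw⟩
  have hsignal : HasLaw (F.signal h) _ F.P := hasLaw_const_mul_cscg hv (F.gain h)
  rwa [signalPower, integral_norm_sq_of_hasLaw_cscg hsignal, Real.toNNReal_coe]

lemma q_rpow_div_qOut {t : ℝ} (ht : 0 < t) (h y : ℂ) (a : F.A) :
    F.q h y a ^ t / F.qOut t h y =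
      cscgPDF (F.noiseVar h / t) (F.signal h a) y /
        cscgPDF (F.noiseVar h / t + F.signalPower h) 0 y := by
  have hσ := F.noiseVar_pos h
  have htilt : 0 < (1 / (Real.pi * F.noiseVar h)) ^ t * (Real.pi * (F.noiseVar h / t)) := by
    positivity
  have hq (a : F.A) : F.q h y a ^ t =
      (1 / (Real.pi * F.noiseVar h)) ^ t * (Real.pi * (F.noiseVar h / t)) *
        cscgPDF (F.noiseVar h / t) (F.signal h a) y := by
    rw [q, Real.mul_rpow (by positivity) (Real.exp_nonneg _), ← Real.exp_mul, cscgPDF, signal,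
      mul_assoc, ← mul_assoc (Real.pi * _), mul_one_div_cancel (by positivity), one_mul]
    congr 2
    field_simp
  have hpdf : Measurable fun u => cscgPDF (F.noiseVar h / t) u y := by
    unfold cscgPDF
    fun_prop
  have hmean := (F.hasLaw_signal h).integral_comp hpdf.aestronglyMeasurable
  rw [integral_cscgPDF (by positivity)] at hmean
  simp_rw [qOut, hq]
  rw [integral_const_mul, mul_div_mul_left _ _ htilt.ne']
  exact congrArg _ hmean

lemma infoDensity_eq {t : ℝ} (ht : 0 < t) (a : F.A) (y h : ℂ) :
    F.infoDensity t a (y, h) =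
      Real.log (1 + F.signalPower h / (F.noiseVar h / t)) +
        (‖y‖ ^ 2 / (F.noiseVar h / t + F.signalPower h) -
          ‖y - F.signal h a‖ ^ 2 / (F.noiseVar h / t)) := by
  rw [infoDensity, F.q_rpow_div_qOut ht,
    log_cscgPDF_div_cscgPDF (div_pos (F.noiseVar_pos h) ht) NNReal.zero_le_coe]

lemma integral_exp_infoDensity {t : ℝ} (ht : 0 < t) (o : ℂ × ℂ) :
    ∫ a, Real.exp (F.infoDensity t a o) ∂F.P = 1 := by
  have hb : 0 < F.noiseVar o.2 / t := div_pos (F.noiseVar_pos _) ht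
  have hexp (a : F.A) : Real.exp (F.infoDensity t a o) = F.q o.2 o.1 a ^ t / F.qOut t o.2 o.1 := by
    refine Real.exp_log ?_
    rw [F.q_rpow_div_qOut ht]
    exact div_pos (cscgPDF_pos hb _ _) (cscgPDF_pos (add_pos_of_pos_of_nonneg hb
      NNReal.zero_le_coe) _ _)
  obtain ⟨a⟩ := F.P.nonempty_of_neZero
  have hqOut : F.qOut t o.2 o.1 ≠ 0 := by
    intro h0
    have := hexp a
    rw [h0, div_zero] at this
    exact (Real.exp_pos _).ne' this
  simp_rw [hexp]
  rw [integral_div, ← qOut, div_self hqOut]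

section SecondOrder

variable (ρ : Measure 𝒮) [IsProbabilityMeasure ρ]

instance : IsProbabilityMeasure (F.law ρ) := by
  unfold law
  infer_instance

lemma lintegral_enorm_sq_input (hPol : AEMeasurable Pol ρ) :
    ∫⁻ p, ‖F.X p.2.1 p.1‖ₑ ^ 2 ∂F.law ρ = ∫⁻ s, Pol s ∂ρ := by
  have hm : Measurable fun p : F.A × 𝒮 × ℂ => F.X p.2.1 p.1 :=
    F.measurable_X.comp (by fun_prop : Measurable fun p : F.A × 𝒮 × ℂ => (p.2.1, p.1))
  rw [law, lintegral_prod_symm _ (hm.enorm.pow_const 2).aemeasurable]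
  simp_rw [F.lintegral_enorm_sq_X]
  rw [lintegral_prod _ (hPol.coe_nnreal_ennreal.comp_fst)]
  simp

variable {ρ} (hint : Integrable (fun s => (Pol s : ℝ)) ρ) (h : ℂ)

include hint in
lemma memLp_output : MemLp (F.output h) 2 (F.law ρ) := by
  have hinput : MemLp (fun p : F.A × 𝒮 × ℂ => F.X p.2.1 p.1) 2 (F.law ρ) := by
    refine ⟨(F.measurable_X.comp (by fun_prop : Measurable fun p : F.A × 𝒮 × ℂ =>
      (p.2.1, p.1))).aestronglyMeasurable, ?_⟩
    rw [eLpNorm_lt_top_iff_lintegral_rpow_enorm_lt_top two_ne_zero ENNReal.ofNat_ne_top]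
    simp only [ENNReal.toReal_ofNat, ENNReal.rpow_ofNat]
    rw [F.lintegral_enorm_sq_input ρ (aemeasurable_coe_nnreal_real_iff.1 hint.1.aemeasurable)]
    simpa [HasFiniteIntegral] using hint.2
  exact (hinput.const_mul h).add (((memLp_two_id_cscg 1).comp_snd ρ).comp_snd F.P)

lemma memLp_signal : MemLp (F.signal h) 2 F.P :=
  memLp_two_of_hasLaw_cscg (F.hasLaw_signal h)

include hint in
lemma integral_norm_sq_output :
    ∫ p, ‖F.output h p‖ ^ 2 ∂F.law ρ = 1 + ‖h‖ ^ 2 * ∫ s, (Pol s : ℝ) ∂ρ := by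
  have hcond (q : 𝒮 × ℂ) :
      ∫ a, ‖F.output h (a, q)‖ ^ 2 ∂F.P = ‖h‖ ^ 2 * Pol q.1 + ‖q.2‖ ^ 2 := by
    have hX := hasLaw_const_mul_cscg (F.hasLaw_X q.1) h
    refine (integral_norm_add_const_sq (memLp_two_of_hasLaw_cscg hX)
      (integral_of_hasLaw_cscg hX) q.2).trans ?_
    rw [integral_norm_sq_of_hasLaw_cscg hX]
    simp
  rw [law, integral_prod_symm _ (F.memLp_output hint h).integrable_norm_pow']
  simp_rw [hcond]
  have hnoise : Integrable (fun z : ℂ => ‖z‖ ^ 2) (cscg 1) :=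
    (memLp_two_id_cscg 1).integrable_norm_pow'
  rw [integral_add ((hint.const_mul _).comp_fst _) (hnoise.comp_snd _),
    integral_fun_fst (f := fun s => ‖h‖ ^ 2 * (Pol s : ℝ)),
    integral_fun_snd (f := fun z : ℂ => ‖z‖ ^ 2), integral_norm_sq_cscg, integral_const_mul]
  simp [add_comm]

lemma integral_inner_output_signal_left (q : 𝒮 × ℂ) :
    ∫ a, inner ℝ (F.output h (a, q)) (F.signal h a) ∂F.P =
      ∫ a, inner ℝ (h * F.X q.1 a) (F.signal h a) ∂F.P :=
  integral_inner_add_const ((memLp_two_of_hasLaw_cscg (F.hasLaw_X q.1)).const_mul h)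
    (F.memLp_signal h) (integral_of_hasLaw_cscg (F.hasLaw_signal h)) q.2

lemma integral_inner_input_signal_le (s : 𝒮) :
    ∫ a, inner ℝ (h * F.X s a) (F.signal h a) ∂F.P ≤ ‖h‖ * √(Pol s : ℝ) * √(F.signalPower h) := by
  have hX := hasLaw_const_mul_cscg (F.hasLaw_X s) h
  refine (integral_inner_le_sqrt_mul_sqrt (memLp_two_of_hasLaw_cscg hX)
    (F.memLp_signal h)).trans_eq ?_
  rw [integral_norm_sq_of_hasLaw_cscg hX, integral_norm_sq_of_hasLaw_cscg (F.hasLaw_signal h)]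
  simp

/-- The correlation `Re E[Y conj(U)]` of the channel output `Y` with the signal part `U` of the
auxiliary model, when `S_T ∼ ρ`. -/
def correlation (ρ : Measure 𝒮) (h : ℂ) : ℝ :=
  ∫ p, inner ℝ (F.output h p) (F.signal h p.1) ∂F.law ρ

include hint in
lemma correlation_eq_integral_integral :
    F.correlation ρ h =
      ∫ q : 𝒮 × ℂ, ∫ a, inner ℝ (h * F.X q.1 a) (F.signal h a) ∂F.P ∂(ρ.prod (cscg 1)) := by
  have hYU := integrable_inner_of_memLp_two (F.memLp_output hint h) ((F.memLp_signal h).comp_fst _)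
  simp_rw [← F.integral_inner_output_signal_left h]
  exact integral_prod_symm _ hYU

include hint in
lemma correlation_le :
    F.correlation ρ h ≤ ‖h‖ * (∫ s, √(Pol s : ℝ) ∂ρ) * √(F.signalPower h) := by
  have hYU := integrable_inner_of_memLp_two (F.memLp_output hint h) ((F.memLp_signal h).comp_fst _)
  have hsection := hYU.integral_prod_right
  simp_rw [F.integral_inner_output_signal_left h] at hsection
  have hbound := (((memLp_two_sqrt hint).integrable one_le_two).const_mul ‖h‖).mul_const
    √(F.signalPower h : ℝ)
  calc F.correlation ρ h
      = ∫ q : 𝒮 × ℂ, ∫ a, inner ℝ (h * F.X q.1 a) (F.signal h a) ∂F.P ∂(ρ.prod (cscg 1)) :=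
        F.correlation_eq_integral_integral hint h
    _ ≤ ∫ q : 𝒮 × ℂ, ‖h‖ * √(Pol q.1 : ℝ) * √(F.signalPower h) ∂(ρ.prod (cscg 1)) :=
        integral_mono hsection (hbound.comp_fst _) fun q => F.integral_inner_input_signal_le h q.1
    _ = _ := by
        rw [integral_fun_fst (f := fun s => ‖h‖ * √(Pol s : ℝ) * √(F.signalPower h)),
          integral_mul_const, integral_const_mul]
        simp

include hint in
lemma integral_norm_sq_output_sub_signal :
    ∫ p, ‖F.output h p - F.signal h p.1‖ ^ 2 ∂F.law ρ =
      1 + ‖h‖ ^ 2 * ∫ s, (Pol s : ℝ) ∂ρ - 2 * F.correlation ρ h + F.signalPower h := by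
  rw [integral_norm_sub_sq (F.memLp_output hint h) ((F.memLp_signal h).comp_fst _),
    F.integral_norm_sq_output hint]
  congr 1
  rw [law, integral_fun_fst (f := fun a => ‖F.signal h a‖ ^ 2), probReal_univ, one_smul,
    integral_norm_sq_of_hasLaw_cscg (F.hasLaw_signal h)]

end SecondOrder

end ForwardModel

/-! ### The maximal GMI of forward models -/

-- `log x ≤ x - 1` at `x = (1 + v / a) / (1 + c ^ 2 / N)` leaves a negative square.
lemma log_add_sub_le_log_one_add_div {a v N c r : ℝ} (ha : 0 < a) (hv : 0 ≤ v) (hN : 0 < N)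
    (hr : r ≤ c * √v) :
    Real.log (1 + v / a) + ((N + c ^ 2) / (a + v) - (N + c ^ 2 - 2 * r + v) / a) ≤
      Real.log (1 + c ^ 2 / N) := by
  have hlog : Real.log (1 + v / a) - Real.log (1 + c ^ 2 / N) ≤
      (1 + v / a) / (1 + c ^ 2 / N) - 1 := by
    rw [← Real.log_div (by positivity) (by positivity)]
    exact Real.log_le_sub_one_of_pos (by positivity)
  have hsquare : (1 + v / a) / (1 + c ^ 2 / N) - 1 +
      ((N + c ^ 2) / (a + v) - (N + c ^ 2 - 2 * (c * √v) + v) / a) =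
      -((c * (a + v) - (N + c ^ 2) * √v) ^ 2 / (a * (N + c ^ 2) * (a + v))) := by
    have hav : 0 < a + v := by positivity
    have hw := Real.sq_sqrt hv
    generalize √v = w at hw
    subst hw
    field_simp
    ring
  have hneg : 0 ≤ (c * (a + v) - (N + c ^ 2) * √v) ^ 2 / (a * (N + c ^ 2) * (a + v)) := by
    positivity
  have hmono : (N + c ^ 2 - 2 * (c * √v) + v) / a ≤ (N + c ^ 2 - 2 * r + v) / a := by gcongr
  linarith

section GMI

variable {κ : Kernel ℂ 𝒮} [IsMarkovKernel κ] {h : ℂ}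

namespace ForwardModel

variable (F : ForwardModel Pol) (hint : Integrable (fun s => (Pol s : ℝ)) (κ h))

include hint

lemma gmiAt_eq {t : ℝ} (ht : 0 < t) :
    F.gmiAt κ t h =
      Real.log (1 + F.signalPower h / (F.noiseVar h / t)) +
        ((1 + ‖h‖ ^ 2 * ∫ s, (Pol s : ℝ) ∂κ h) / (F.noiseVar h / t + F.signalPower h) -
          (1 + ‖h‖ ^ 2 * (∫ s, (Pol s : ℝ) ∂κ h) - 2 * F.correlation (κ h) h + F.signalPower h) /
            (F.noiseVar h / t)) := by
  have hY := F.memLp_output hint h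
  have hYU := hY.sub ((F.memLp_signal h).comp_fst _)
  have hY2 := hY.integrable_norm_pow'.div_const (F.noiseVar h / t + F.signalPower h)
  have hYU2 : Integrable
      (fun p => ‖F.output h p - F.signal h p.1‖ ^ 2 / (F.noiseVar h / t)) (F.law (κ h)) :=
    hYU.integrable_norm_pow'.div_const _
  have hdiff : Integrable
      (fun p => ‖F.output h p‖ ^ 2 / (F.noiseVar h / t + F.signalPower h) -
        ‖F.output h p - F.signal h p.1‖ ^ 2 / (F.noiseVar h / t)) (F.law (κ h)) :=
    hY2.sub hYU2
  simp_rw [gmiAt_eq_integral_law, F.infoDensity_eq ht]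
  rw [integral_add (integrable_const _) hdiff, integral_sub hY2 hYU2, integral_const,
    probReal_univ, one_smul, integral_div, integral_div, F.integral_norm_sq_output hint,
    F.integral_norm_sq_output_sub_signal hint]

lemma gmiAt_le {t : ℝ} (ht : 0 ≤ t) : F.gmiAt κ t h ≤ Real.log (1 + snr κ Pol h) := by
  rcases ht.eq_or_lt with rfl | ht
  · simpa [gmiAt, qOut] using log_one_add_snr_nonneg κ Pol h
  rw [F.gmiAt_eq hint ht, snr_eq_div_residualPower, ← residualPower_add_sq hint]
  exact log_add_sub_le_log_one_add_div (div_pos (F.noiseVar_pos h) ht) NNReal.zero_le_coe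
    (residualPower_pos κ Pol h) (F.correlation_le hint h)

end ForwardModel

end GMI

section OptimalModel

variable [Nonempty 𝒮]

variable (Pol) in
/-- A CSIT value to which `Pol` assigns positive power, if there is one; its channel input spans
the entries of the symbol in `optimalModel`. -/
def activeState : 𝒮 := Classical.epsilon fun s => Pol s ≠ 0

variable (κ : Kernel ℂ 𝒮) (hPol : Measurable Pol)

/-- The fully correlated symbol `X(s) = √P(s) W`, `W ∼ 𝒞𝒩(0, 1)`, with the linear minimum
mean-square error model `Y ≈ h E[√P(S_T) | H = h] W + noise`. Here `W` is written as
`X(s₀) / √P(s₀)` with `s₀ = activeState Pol`; if all powers are zero, the quotient and the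
conditional mean are both zero. -/
def optimalModel : ForwardModel Pol where
  A := ℂ
  P := cscg 1
  X s a := (√(Pol s : ℝ) : ℝ) * a
  measurable_X := by
    unfold Function.uncurry
    fun_prop
  jointlyCSCG w := by
    refine ⟨_, Eq.trans ?_ (map_const_mul_cscg 1 (w.sum fun s c => c * (√(Pol s : ℝ) : ℝ)))⟩
    simp only [Finsupp.sum, Finset.sum_mul, mul_assoc]
  law_X s := by
    rw [map_const_mul_cscg]
    congr 1
    ext
    simp [Real.sq_sqrt]
  Xbar _ a := (√(Pol (activeState Pol) : ℝ) : ℝ) * a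
  measurable_Xbar _ := by fun_prop
  linear_Xbar _ _ _ := ⟨Finsupp.single (activeState Pol) 1, by simp⟩
  gain h := h * (sqrtMean κ Pol h / √(Pol (activeState Pol) : ℝ) : ℝ)
  noiseVar := residualPower κ Pol
  noiseVar_pos := residualPower_pos κ Pol

lemma sqrtMean_div_mul_sqrt_activeState (h : ℂ) :
    sqrtMean κ Pol h / √(Pol (activeState Pol) : ℝ) * √(Pol (activeState Pol) : ℝ) =
      sqrtMean κ Pol h := by
  refine div_mul_cancel_of_imp fun hzero => ?_
  have hPol0 : Pol (activeState Pol) = 0 := by simpa using hzero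
  have hall (s : 𝒮) : Pol s = 0 := by
    by_contra hs
    exact Classical.epsilon_spec (p := fun s => Pol s ≠ 0) ⟨s, hs⟩ hPol0
  simp [sqrtMean, hall]

lemma signal_optimalModel (h : ℂ) :
    (optimalModel κ hPol).signal h = fun a : ℂ => h * (sqrtMean κ Pol h : ℝ) * a := by
  funext (a : ℂ)
  rw [← sqrtMean_div_mul_sqrt_activeState κ h, Complex.ofReal_mul, ← mul_assoc, mul_assoc _ _ a]
  rfl

lemma signalPower_optimalModel (h : ℂ) :
    ((optimalModel κ hPol).signalPower h : ℝ) = (‖h‖ * sqrtMean κ Pol h) ^ 2 := by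
  have hlaw := hasLaw_const_mul_cscg (HasLaw.id (μ := cscg 1)) (h * (sqrtMean κ Pol h : ℝ))
  rw [ForwardModel.signalPower, signal_optimalModel]
  refine (congrArg (fun x => ((Real.toNNReal x : ℝ≥0) : ℝ))
    (integral_norm_sq_of_hasLaw_cscg hlaw)).trans ?_
  simp [mul_pow, mul_nonneg, sq_nonneg]

lemma correlation_optimalModel [IsMarkovKernel κ] {h : ℂ}
    (hint : Integrable (fun s => (Pol s : ℝ)) (κ h)) :
    (optimalModel κ hPol).correlation (κ h) h = (‖h‖ * sqrtMean κ Pol h) ^ 2 := by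
  have hinner (x m : ℝ) (a : ℂ) :
      inner ℝ (h * (x * a)) (h * m * a) = ‖h‖ ^ 2 * m * x * ‖a‖ ^ 2 := by
    rw [mul_left_comm, mul_right_comm, mul_comm _ (m : ℂ), ← Complex.real_smul,
      ← Complex.real_smul, real_inner_smul_left, real_inner_smul_right,
      real_inner_self_eq_norm_sq, norm_mul]
    ring
  have hsection (s : 𝒮) :
      ∫ a, inner ℝ (h * (optimalModel κ hPol).X s a) ((optimalModel κ hPol).signal h a)
        ∂(optimalModel κ hPol).P = ‖h‖ ^ 2 * sqrtMean κ Pol h * √(Pol s : ℝ) := by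
    rw [signal_optimalModel]
    change ∫ a : ℂ, inner ℝ (h * ((√(Pol s : ℝ) : ℝ) * a)) (h * (sqrtMean κ Pol h : ℝ) * a)
      ∂cscg 1 = _
    simp_rw [hinner]
    rw [integral_const_mul, integral_norm_sq_cscg, NNReal.coe_one, mul_one]
  rw [ForwardModel.correlation_eq_integral_integral _ hint]
  simp_rw [hsection]
  rw [integral_const_mul, integral_fun_fst (f := fun s => √(Pol s : ℝ)), probReal_univ, one_smul,
    ← sqrtMean]
  ring

lemma gmiAt_optimalModel [IsMarkovKernel κ] {h : ℂ}
    (hint : Integrable (fun s => (Pol s : ℝ)) (κ h)) :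
    (optimalModel κ hPol).gmiAt κ 1 h = Real.log (1 + snr κ Pol h) := by
  have hN := residualPower_pos κ Pol h
  rw [ForwardModel.gmiAt_eq _ hint one_pos, ← residualPower_add_sq hint, signalPower_optimalModel,
    correlation_optimalModel κ hPol hint, snr_eq_div_residualPower, div_one,
    show (optimalModel κ hPol).noiseVar h = residualPower κ Pol h from rfl]
  have hresidual : residualPower κ Pol h + (‖h‖ * sqrtMean κ Pol h) ^ 2 -
      2 * (‖h‖ * sqrtMean κ Pol h) ^ 2 + (‖h‖ * sqrtMean κ Pol h) ^ 2 = residualPower κ Pol h := by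
    ring
  rw [hresidual, div_self (by positivity), div_self hN.ne', sub_self, add_zero]

end OptimalModel

section Rate

variable {PH : Measure ℂ} {κ : Kernel ℂ 𝒮} [IsMarkovKernel κ]

lemma log_one_add_snr_le {h : ℂ} (hint : Integrable (fun s => (Pol s : ℝ)) (κ h)) :
    Real.log (1 + snr κ Pol h) ≤ Real.log (1 + ‖h‖ ^ 2) + ∫ s, (Pol s : ℝ) ∂κ h := by
  have hN := residualPower_pos κ Pol h
  have hmean : 0 ≤ ∫ s, (Pol s : ℝ) ∂κ h := integral_nonneg fun _ => NNReal.zero_le_coe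
  have hsnr : 1 + snr κ Pol h ≤ (1 + ‖h‖ ^ 2) * (1 + ∫ s, (Pol s : ℝ) ∂κ h) :=
    calc 1 + snr κ Pol h
        = (1 + ‖h‖ ^ 2 * ∫ s, (Pol s : ℝ) ∂κ h) / residualPower κ Pol h := by
          rw [snr_eq_div_residualPower, ← residualPower_add_sq hint, add_div, div_self hN.ne']
      _ ≤ 1 + ‖h‖ ^ 2 * ∫ s, (Pol s : ℝ) ∂κ h :=
          div_le_self (by positivity) (one_le_residualPower κ Pol h)
      _ ≤ _ := by nlinarith [sq_nonneg ‖h‖]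
  calc Real.log (1 + snr κ Pol h)
      ≤ Real.log ((1 + ‖h‖ ^ 2) * (1 + ∫ s, (Pol s : ℝ) ∂κ h)) :=
        Real.log_le_log (by linarith [snr_nonneg κ Pol h]) hsnr
    _ = Real.log (1 + ‖h‖ ^ 2) + Real.log (1 + ∫ s, (Pol s : ℝ) ∂κ h) :=
        Real.log_mul (by positivity) (by positivity)
    _ ≤ _ := by
        gcongr
        linarith [Real.log_le_sub_one_of_pos (x := 1 + ∫ s, (Pol s : ℝ) ∂κ h) (by positivity)]

variable [SFinite PH]

lemma ae_integrable_kernel (hint : Integrable (fun p : ℂ × 𝒮 => (Pol p.2 : ℝ)) (PH ⊗ₘ κ)) :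
    ∀ᵐ h ∂PH, Integrable (fun s => (Pol s : ℝ)) (κ h) :=
  ((Measure.integrable_compProd_iff hint.1).1 hint).1

variable (hPol : Measurable Pol) (hH : Integrable (fun h : ℂ => Real.log (1 + ‖h‖ ^ 2)) PH)
  (hint : Integrable (fun p : ℂ × 𝒮 => (Pol p.2 : ℝ)) (PH ⊗ₘ κ))

include hPol hH hint

lemma integrable_log_one_add_snr : Integrable (fun h => Real.log (1 + snr κ Pol h)) PH := by
  have hmean : Integrable (fun h => ∫ s, (Pol s : ℝ) ∂κ h) PH := by
    simpa using ((Measure.integrable_compProd_iff hint.1).1 hint).2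
  refine (hH.add hmean).mono' ((measurable_snr hPol).const_add 1).log.aestronglyMeasurable ?_
  filter_upwards [ae_integrable_kernel hint] with h hh
  rw [Real.norm_of_nonneg (log_one_add_snr_nonneg κ Pol h)]
  exact log_one_add_snr_le hh

lemma isGreatest_forwardGMIs [Nonempty 𝒮] :
    IsGreatest (forwardGMIs PH κ Pol) (∫ h, Real.log (1 + snr κ Pol h) ∂PH) := by
  have hrate := integrable_log_one_add_snr hPol hH hint
  constructor
  · have hopt : (fun h => Real.log (1 + snr κ Pol h)) =ᵐ[PH] (optimalModel κ hPol).gmiAt κ 1 := by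
      filter_upwards [ae_integrable_kernel hint] with h hh
      exact (gmiAt_optimalModel κ hPol hh).symm
    exact ⟨optimalModel κ hPol, 1, zero_le_one, hrate.congr hopt, integral_congr_ae hopt⟩
  · rintro _ ⟨F, t, ht, hF, rfl⟩
    refine integral_mono_ae hF hrate ?_
    filter_upwards [ae_integrable_kernel hint] with h hh
    exact F.gmiAt_le hh ht

end Rate

/-! ### The joint law of symbol, states and noise -/

namespace ForwardModel

variable (F : ForwardModel Pol)

/-- The receiver's observation `(Y, H)` as a function of the adaptive symbol and of
`((H, S_T), Z)`. -/
def observation (a : F.A) (b : (ℂ × 𝒮) × ℂ) : ℂ × ℂ :=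
  (F.output b.1.1 (a, b.1.2, b.2), b.1.1)

lemma measurable_observation : Measurable (Function.uncurry F.observation) := by
  have hX : Measurable fun p : F.A × (ℂ × 𝒮) × ℂ => F.X p.2.1.2 p.1 :=
    F.measurable_X.comp
      (by fun_prop : Measurable fun p : F.A × (ℂ × 𝒮) × ℂ => (p.2.1.2, p.1))
  unfold Function.uncurry observation output
  fun_prop

variable (PH : Measure ℂ) [SFinite PH] (κ : Kernel ℂ 𝒮) [IsMarkovKernel κ]

/-- `ForwardModel.law (κ h)` as a kernel in `h`: the law of `(A, S_T, Z)` given `H = h`. -/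
def condLaw : Kernel ℂ (F.A × 𝒮 × ℂ) :=
  Kernel.const ℂ F.P ×ₖ (κ ×ₖ Kernel.const ℂ (cscg 1))

instance : IsMarkovKernel (F.condLaw κ) := by
  unfold condLaw
  infer_instance

lemma condLaw_apply (h : ℂ) : F.condLaw κ h = F.law (κ h) := by
  rw [condLaw, Kernel.prod_apply, Kernel.prod_apply, Kernel.const_apply, Kernel.const_apply, law]

lemma measurePreserving_symbol_state_noise :
    MeasurePreserving (fun x : ℂ × F.A × 𝒮 × ℂ => (x.2.1, (x.1, x.2.2.1), x.2.2.2))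
      (PH ⊗ₘ F.condLaw κ) (F.P.prod ((PH ⊗ₘ κ).prod (cscg 1))) := by
  refine ⟨by fun_prop, Measure.ext_of_lintegral _ fun f hf => ?_⟩
  rw [lintegral_map hf (by fun_prop), Measure.lintegral_compProd (by fun_prop),
    lintegral_prod_symm _ hf.aemeasurable, lintegral_prod _ (by fun_prop),
    Measure.lintegral_compProd (by fun_prop)]
  refine lintegral_congr fun h => ?_
  rw [condLaw_apply, law, lintegral_prod_symm _ (by fun_prop), lintegral_prod _ (by fun_prop)]

variable {PH κ} {t : ℝ}

section Conditional

variable {h : ℂ} (hint : Integrable (fun s => (Pol s : ℝ)) (κ h)) (ht : 0 < t)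

include hint ht

lemma integrable_infoDensity_output :
    Integrable (fun p => F.infoDensity t p.1 (F.output h p, h)) (F.law (κ h)) := by
  have hY := F.memLp_output hint h
  have hYU := hY.sub ((F.memLp_signal h).comp_fst _)
  simp_rw [F.infoDensity_eq ht]
  exact (integrable_const _).add
    ((hY.integrable_norm_pow'.div_const _).sub (hYU.integrable_norm_pow'.div_const _))

lemma integral_norm_infoDensity_output_le :
    ∫ p, ‖F.infoDensity t p.1 (F.output h p, h)‖ ∂F.law (κ h) ≤
      Real.log (1 + F.signalPower h / (F.noiseVar h / t)) +
        ((1 + ‖h‖ ^ 2 * ∫ s, (Pol s : ℝ) ∂κ h) / (F.noiseVar h / t + F.signalPower h) +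
          (∫ p, ‖F.output h p - F.signal h p.1‖ ^ 2 ∂F.law (κ h)) / (F.noiseVar h / t)) := by
  have hb : 0 < F.noiseVar h / t := div_pos (F.noiseVar_pos h) ht
  have hY := F.memLp_output hint h
  have hYU := hY.sub ((F.memLp_signal h).comp_fst _)
  have hY2 := hY.integrable_norm_pow'.div_const (F.noiseVar h / t + F.signalPower h)
  have hYU2 : Integrable
      (fun p => ‖F.output h p - F.signal h p.1‖ ^ 2 / (F.noiseVar h / t)) (F.law (κ h)) :=
    hYU.integrable_norm_pow'.div_const _
  rw [← F.integral_norm_sq_output hint, ← integral_div, ← integral_div,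
    ← integral_add hY2 hYU2]
  have hsum := hY2.add hYU2
  refine (integral_mono (F.integrable_infoDensity_output hint ht).norm
    ((integrable_const (Real.log (1 + F.signalPower h / (F.noiseVar h / t)))).add hsum)
    fun p => ?_).trans_eq ?_
  · rw [F.infoDensity_eq ht]
    refine (norm_add_le _ _).trans (add_le_add (Real.norm_of_nonneg ?_).le ?_)
    · exact Real.log_nonneg (le_add_of_nonneg_right (by positivity))
    · refine (norm_sub_le _ _).trans_eq ?_
      rw [Real.norm_of_nonneg (by positivity), Real.norm_of_nonneg (by positivity)]
      rfl
  · refine (integral_add (integrable_const _) hsum).trans ?_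
    rw [integral_const, probReal_univ, one_smul]
    rfl

end Conditional

variable (hm : Measurable (Function.uncurry (F.infoDensity t)))

include hm in
lemma measurable_infoDensity_observation :
    Measurable fun x : F.A × (ℂ × 𝒮) × ℂ => F.infoDensity t x.1 (F.observation x.1 x.2) :=
  hm.comp (g := Function.uncurry (F.infoDensity t))
    (f := fun x : F.A × (ℂ × 𝒮) × ℂ => (x.1, F.observation x.1 x.2))
    (measurable_fst.prodMk F.measurable_observation)

include hm in
lemma integrable_infoDensity_observation
    (hcond : ∀ᵐ h ∂PH,
      Integrable (fun p => F.infoDensity t p.1 (F.output h p, h)) (F.law (κ h)))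
    (habs : Integrable
      (fun h => ∫ p, ‖F.infoDensity t p.1 (F.output h p, h)‖ ∂F.law (κ h)) PH) :
    Integrable (fun x => F.infoDensity t x.1 (F.observation x.1 x.2))
      (F.P.prod ((PH ⊗ₘ κ).prod (cscg 1))) := by
  have hJ := (F.measurable_infoDensity_observation hm).aestronglyMeasurable
    (μ := F.P.prod ((PH ⊗ₘ κ).prod (cscg 1)))
  have hmp := F.measurePreserving_symbol_state_noise PH κ
  rw [← hmp.integrable_comp hJ,
    Measure.integrable_compProd_iff (hJ.comp_measurePreserving hmp)]
  simp only [condLaw_apply]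
  exact ⟨hcond, habs⟩

lemma integral_infoDensity_observation
    (hJ : Integrable (fun x => F.infoDensity t x.1 (F.observation x.1 x.2))
      (F.P.prod ((PH ⊗ₘ κ).prod (cscg 1)))) :
    ∫ x, F.infoDensity t x.1 (F.observation x.1 x.2) ∂F.P.prod ((PH ⊗ₘ κ).prod (cscg 1)) =
      ∫ h, F.gmiAt κ t h ∂PH := by
  have hmp := F.measurePreserving_symbol_state_noise PH κ
  have hJ' : Integrable (fun x : ℂ × F.A × 𝒮 × ℂ => F.infoDensity t x.2.1 (F.output x.1 x.2, x.1))
      (PH ⊗ₘ F.condLaw κ) := (hmp.integrable_comp hJ.1).2 hJ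
  rw [← hmp.map_eq] at hJ ⊢
  rw [integral_map hmp.aemeasurable hJ.1]
  refine (Measure.integral_compProd hJ').trans (integral_congr_ae (.of_forall fun h => ?_))
  simp only [gmiAt_eq_integral_law, condLaw_apply]

include hm in
lemma stronglyMeasurable_integral_norm_infoDensity_output :
    StronglyMeasurable
      fun h => ∫ p, ‖F.infoDensity t p.1 (F.output h p, h)‖ ∂F.law (κ h) := by
  have hJ : Measurable fun x : ℂ × F.A × 𝒮 × ℂ =>
      F.infoDensity t x.2.1 (F.output x.1 x.2, x.1) :=
    (F.measurable_infoDensity_observation hm).comp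
      (f := fun x : ℂ × F.A × 𝒮 × ℂ => (x.2.1, (x.1, x.2.2.1), x.2.2.2)) (by fun_prop)
  have hkernel := StronglyMeasurable.integral_kernel_prod_right' (κ := F.condLaw κ)
    hJ.norm.stronglyMeasurable
  simp_rw [condLaw_apply] at hkernel
  exact hkernel

end ForwardModel

section OptimalModel

variable [Nonempty 𝒮] {κ : Kernel ℂ 𝒮} (hPol : Measurable Pol)

lemma infoDensity_optimalModel (a y h : ℂ) :
    (optimalModel κ hPol).infoDensity 1 a (y, h) =
      Real.log (1 + snr κ Pol h) +
        (‖y‖ ^ 2 / (residualPower κ Pol h + (‖h‖ * sqrtMean κ Pol h) ^ 2) -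
          ‖y - h * (sqrtMean κ Pol h : ℝ) * a‖ ^ 2 / residualPower κ Pol h) := by
  refine (ForwardModel.infoDensity_eq _ one_pos _ y h).trans ?_
  rw [signalPower_optimalModel, signal_optimalModel, div_one, snr_eq_div_residualPower]
  rfl

variable [IsMarkovKernel κ]

lemma measurable_infoDensity_optimalModel :
    Measurable (Function.uncurry ((optimalModel κ hPol).infoDensity 1)) := by
  have hmean := measurable_sqrtMean (κ := κ) hPol
  have hres := measurable_residualPower (κ := κ) hPol
  have hsnr := measurable_snr (κ := κ) hPol
  have heq : Function.uncurry ((optimalModel κ hPol).infoDensity 1) =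
      fun p : ℂ × ℂ × ℂ => Real.log (1 + snr κ Pol p.2.2) +
        (‖p.2.1‖ ^ 2 / (residualPower κ Pol p.2.2 + (‖p.2.2‖ * sqrtMean κ Pol p.2.2) ^ 2) -
          ‖p.2.1 - p.2.2 * (sqrtMean κ Pol p.2.2 : ℝ) * p.1‖ ^ 2 / residualPower κ Pol p.2.2) :=
    funext fun p => infoDensity_optimalModel hPol p.1 p.2.1 p.2.2
  rw [heq]
  fun_prop

section Conditional

variable {h : ℂ} (hint : Integrable (fun s => (Pol s : ℝ)) (κ h))

include hint

lemma integral_norm_sq_output_sub_signal_optimalModel :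
    ∫ p, ‖(optimalModel κ hPol).output h p - (optimalModel κ hPol).signal h p.1‖ ^ 2
      ∂(optimalModel κ hPol).law (κ h) = residualPower κ Pol h := by
  rw [ForwardModel.integral_norm_sq_output_sub_signal _ hint, signalPower_optimalModel,
    correlation_optimalModel κ hPol hint, ← residualPower_add_sq hint]
  ring

lemma integrable_infoDensity_output_optimalModel :
    Integrable (fun p => (optimalModel κ hPol).infoDensity 1 p.1
      ((optimalModel κ hPol).output h p, h)) ((optimalModel κ hPol).law (κ h)) :=
  (optimalModel κ hPol).integrable_infoDensity_output hint one_pos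

lemma integral_norm_infoDensity_optimalModel_le :
    ∫ p, ‖(optimalModel κ hPol).infoDensity 1 p.1 ((optimalModel κ hPol).output h p, h)‖
      ∂(optimalModel κ hPol).law (κ h) ≤ Real.log (1 + snr κ Pol h) + 2 := by
  have hN := residualPower_pos κ Pol h
  refine (ForwardModel.integral_norm_infoDensity_output_le _ hint one_pos).trans_eq ?_
  rw [integral_norm_sq_output_sub_signal_optimalModel hPol hint, ← residualPower_add_sq hint,
    signalPower_optimalModel, div_one, snr_eq_div_residualPower,
    show (optimalModel κ hPol).noiseVar h = residualPower κ Pol h from rfl,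
    div_self hN.ne', div_self (by positivity)]
  ring

end Conditional

section Joint

variable {PH : Measure ℂ} [IsFiniteMeasure PH]
  (hH : Integrable (fun h : ℂ => Real.log (1 + ‖h‖ ^ 2)) PH)
  (hint : Integrable (fun p : ℂ × 𝒮 => (Pol p.2 : ℝ)) (PH ⊗ₘ κ))

include hH hint

lemma integrable_infoDensity_observation_optimalModel :
    Integrable (fun x => (optimalModel κ hPol).infoDensity 1 x.1
      ((optimalModel κ hPol).observation x.1 x.2))
      ((optimalModel κ hPol).P.prod ((PH ⊗ₘ κ).prod (cscg 1))) := by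
  have hm := measurable_infoDensity_optimalModel (κ := κ) hPol
  refine ForwardModel.integrable_infoDensity_observation _ hm ?_ ?_
  · filter_upwards [ae_integrable_kernel hint] with h hh
    exact integrable_infoDensity_output_optimalModel hPol hh
  · refine ((integrable_log_one_add_snr hPol hH hint).add (integrable_const 2)).mono'
      (ForwardModel.stronglyMeasurable_integral_norm_infoDensity_output _
        hm).aestronglyMeasurable ?_
    filter_upwards [ae_integrable_kernel hint] with h hh
    rw [Real.norm_of_nonneg (integral_nonneg fun _ => norm_nonneg _)]
    exact integral_norm_infoDensity_optimalModel_le hPol hh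

lemma integral_infoDensity_observation_optimalModel :
    ∫ x, (optimalModel κ hPol).infoDensity 1 x.1 ((optimalModel κ hPol).observation x.1 x.2)
      ∂(optimalModel κ hPol).P.prod ((PH ⊗ₘ κ).prod (cscg 1)) =
      ∫ h, Real.log (1 + snr κ Pol h) ∂PH := by
  rw [ForwardModel.integral_infoDensity_observation _
    (integrable_infoDensity_observation_optimalModel hPol hH hint)]
  refine integral_congr_ae ?_
  filter_upwards [ae_integrable_kernel hint] with h hh
  exact gmiAt_optimalModel κ hPol hh

end Joint

end OptimalModel

end Models

/-! ### Random coding with a threshold decoder -/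

section WeakLaw

lemma tendsto_measure_sum_range_lt {Ω : Type*} [MeasurableSpace Ω] {P : Measure Ω}
    [IsFiniteMeasure P] {X : ℕ → Ω → ℝ} (hX : Integrable (X 0) P)
    (hindep : Pairwise fun i j => IndepFun (X i) (X j) P)
    (hident : ∀ i, IdentDistrib (X i) (X 0) P P) {c : ℝ} (hc : c < ∫ ω, X 0 ω ∂P) :
    Filter.Tendsto (fun n : ℕ => P {ω | ∑ i ∈ Finset.range n, X i ω < n * c})
      Filter.atTop (nhds 0) := by
  have hmean : TendstoInMeasure P (fun (n : ℕ) ω => (∑ i ∈ Finset.range n, X i ω) / n)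
      Filter.atTop fun _ => ∫ ω, X 0 ω ∂P := by
    refine tendstoInMeasure_of_tendsto_ae (fun n => ?_) (strong_law_ae_real X hX hindep hident)
    have hX' (i : ℕ) := (hident i).aemeasurable_fst.aestronglyMeasurable
    exact (by fun_prop : AEMeasurable
      (fun ω => (∑ i ∈ Finset.range n, X i ω) / n) P).aestronglyMeasurable
  rw [tendstoInMeasure_iff_dist] at hmean
  refine tendsto_of_tendsto_of_tendsto_of_le_of_le' tendsto_const_nhds
    (hmean _ (sub_pos.2 hc)) (.of_forall fun _ => zero_le) ?_
  filter_upwards [Filter.eventually_gt_atTop 0] with n hn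
  refine measure_mono fun ω hω => ?_
  have hlt : (∑ i ∈ Finset.range n, X i ω) / n < c := by
    rw [div_lt_iff₀ (by exact_mod_cast hn), mul_comm]
    exact hω
  rw [Set.mem_ofPred_eq, dist_comm, Real.dist_eq]
  exact (sub_le_sub_left hlt.le _).trans (le_abs_self _)

lemma map_infinitePi_fin_val {T : Type*} [MeasurableSpace T] (ρ : Measure T)
    [IsProbabilityMeasure ρ] (n : ℕ) :
    (Measure.infinitePi fun _ : ℕ => ρ).map (fun ω (i : Fin n) => ω i) =
      Measure.pi fun _ : Fin n => ρ := by
  rw [Measure.map_infinitePi_infinitePi_of_inj (P := fun _ : ℕ => ρ) Fin.val_injective,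
    Measure.infinitePi_eq_pi]

lemma tendsto_measure_pi_sum_lt {T : Type*} [MeasurableSpace T] {ρ : Measure T}
    [IsProbabilityMeasure ρ] {f : T → ℝ} (hfm : Measurable f) (hf : Integrable f ρ) {c : ℝ}
    (hc : c < ∫ x, f x ∂ρ) :
    Filter.Tendsto (fun n : ℕ => Measure.pi (fun _ : Fin n => ρ) {x | ∑ i, f (x i) < n * c})
      Filter.atTop (nhds 0) := by
  let P : Measure (ℕ → T) := Measure.infinitePi fun _ => ρ
  have hmp (i : ℕ) : MeasurePreserving (Function.eval i) P ρ :=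
    measurePreserving_eval_infinitePi (fun _ : ℕ => ρ) i
  have hident (i : ℕ) : IdentDistrib (fun ω => f (ω i)) (fun ω => f (ω 0)) P P :=
    IdentDistrib.comp ⟨(hmp i).aemeasurable, (hmp 0).aemeasurable,
      (hmp i).map_eq.trans (hmp 0).map_eq.symm⟩ hfm
  have hmean : ∫ ω, f (ω 0) ∂P = ∫ x, f x ∂ρ :=
    (hmp 0).hasLaw.integral_comp hfm.aestronglyMeasurable
  have htail := tendsto_measure_sum_range_lt (P := P) (X := fun i ω => f (ω i))
    ((hmp 0).integrable_comp_of_integrable hf)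
    (fun i j hij => (iIndepFun_infinitePi (P := fun _ : ℕ => ρ) (X := fun _ => f)
      fun _ => hfm).indepFun hij) hident (hmean ▸ hc)
  refine htail.congr fun n => ?_
  rw [← map_infinitePi_fin_val, Measure.map_apply (by fun_prop)
    (measurableSet_lt (by fun_prop) measurable_const)]
  congr with ω
  simp [Fin.sum_univ_eq_sum_range (fun i => f (ω i))]

end WeakLaw

lemma tendsto_floor_exp_mul_exp_neg {r c : ℝ} (hrc : r < c) :
    Filter.Tendsto (fun n : ℕ => (⌊Real.exp (n * r)⌋₊ : ℝ≥0∞) *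
      ENNReal.ofReal (Real.exp (-(n * c)))) Filter.atTop (nhds 0) := by
  have hexp : Filter.Tendsto (fun n : ℕ => ENNReal.ofReal (Real.exp (-(n * (c - r)))))
      Filter.atTop (nhds 0) := by
    rw [← ENNReal.ofReal_zero]
    exact ENNReal.tendsto_ofReal (Real.tendsto_exp_neg_atTop_nhds_zero.comp
      (tendsto_natCast_atTop_atTop.atTop_mul_const (sub_pos.2 hrc)))
  refine tendsto_of_tendsto_of_tendsto_of_le_of_le tendsto_const_nhds hexp
    (fun _ => zero_le) fun n => ?_
  rw [← ENNReal.ofReal_natCast, ← ENNReal.ofReal_mul (Nat.cast_nonneg _)]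
  refine ENNReal.ofReal_le_ofReal ?_
  calc (⌊Real.exp (n * r)⌋₊ : ℝ) * Real.exp (-(n * c))
      ≤ Real.exp (n * r) * Real.exp (-(n * c)) := by
        gcongr
        exact Nat.floor_le (Real.exp_pos _).le
    _ = Real.exp (-(n * (c - r))) := by
        rw [← Real.exp_add]
        ring_nf

section ThresholdDecoding

variable {ι W B O : Type*} {J : W → O → ℝ} {θ : ℝ}

/-- The decoder that, given the codebook `cb`, returns a message whose score with the observation
reaches the threshold `θ`, and an arbitrary message if there is none. -/
def thresholdDec [Nonempty ι] (J : W → O → ℝ) (θ : ℝ) (cb : ι → W) (o : O) : ι :=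
  Classical.epsilon fun m => θ ≤ J (cb m) o

lemma thresholdDec_eq [Nonempty ι] {cb : ι → W} {o : O} {m : ι} (hm : θ ≤ J (cb m) o)
    (hother : ∀ m' ≠ m, J (cb m') o < θ) : thresholdDec J θ cb o = m := by
  by_contra hne
  exact (hother _ hne).not_ge (Classical.epsilon_spec (p := fun m => θ ≤ J (cb m) o) ⟨m, hm⟩)

variable [MeasurableSpace W] [MeasurableSpace B] [MeasurableSpace O]
  {Q : Measure W} [IsProbabilityMeasure Q] {β : Measure B} [IsProbabilityMeasure β]
  {out : W → B → O} (hJ : Measurable (Function.uncurry J))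
  (hout : Measurable (Function.uncurry out))

section Measurability

variable [Finite ι] [Nonempty ι]

include hJ

lemma measurable_thresholdDec [MeasurableSpace ι] :
    Measurable fun p : (ι → W) × O => thresholdDec J θ p.1 p.2 := by
  have hepsilon : Measurable (Classical.epsilon : (ι → Prop) → ι) := measurable_of_finite _
  refine hepsilon.comp (measurable_pi_lambda _ fun m => measurableSet_setOfPred.1 ?_)
  exact measurableSet_le measurable_const
    (hJ.comp (f := fun p : (ι → W) × O => (p.1 m, p.2)) (by fun_prop))

include hout

lemma measurableSet_thresholdDec_ne (m : ι) :
    MeasurableSet {p : (ι → W) × B | thresholdDec J θ p.1 (out (p.1 m) p.2) ≠ m} := by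
  let _ : MeasurableSpace ι := ⊤
  have hobservation : Measurable fun p : (ι → W) × B => (p.1, out (p.1 m) p.2) :=
    measurable_fst.prodMk (hout.comp (f := fun p : (ι → W) × B => (p.1 m, p.2)) (by fun_prop))
  exact ((measurable_thresholdDec hJ).comp hobservation) (MeasurableSet.of_discrete (s := {m}ᶜ))

lemma measurable_measure_thresholdDec_ne (m : ι) :
    Measurable fun cb : ι → W => β {b | thresholdDec J θ cb (out (cb m) b) ≠ m} :=
  measurable_measure_prodMk_left (measurableSet_thresholdDec_ne hJ hout m)

end Measurability

variable [Fintype ι]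

lemma measurePreserving_eval_pair {m m' : ι} (hm : m ≠ m') :
    MeasurePreserving (fun cb : ι → W => (cb m, cb m')) (Measure.pi fun _ => Q) (Q.prod Q) := by
  have hindep := (iIndepFun_pi (μ := fun _ : ι => Q) (X := fun _ w => w)
    fun _ => aemeasurable_id).indepFun hm
  refine ⟨by fun_prop, ?_⟩
  rw [(indepFun_iff_map_prod_eq_prod_map_map (measurable_pi_apply m).aemeasurable
    (measurable_pi_apply m').aemeasurable).1 hindep]
  congr
  · exact (measurePreserving_eval (fun _ : ι => Q) m).map_eq
  · exact (measurePreserving_eval (fun _ : ι => Q) m').map_eq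

lemma measure_le_le_exp_neg {g : W → ℝ} (hexp : ∫ w, Real.exp (g w) ∂Q = 1) :
    Q {w | θ ≤ g w} ≤ ENNReal.ofReal (Real.exp (-θ)) := by
  have hint : Integrable (fun w => Real.exp (1 * g w)) Q := by
    simp_rw [one_mul]
    exact .of_integral_ne_zero (hexp ▸ one_ne_zero)
  rw [← ofReal_measureReal]
  refine ENNReal.ofReal_le_ofReal ((measure_ge_le_exp_mul_mgf θ zero_le_one hint).trans_eq ?_)
  simp [mgf, hexp]

include hJ hout

lemma measurable_score_output :
    Measurable fun p : W × W × B => J p.1 (out p.2.1 p.2.2) :=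
  hJ.comp (f := fun p : W × W × B => (p.1, out p.2.1 p.2.2))
    (measurable_fst.prodMk (hout.comp (f := fun p : W × W × B => p.2) measurable_snd))

lemma measure_score_output_lt (m : ι) :
    ((Measure.pi fun _ : ι => Q).prod β) {p | J (p.1 m) (out (p.1 m) p.2) < θ} =
      (Q.prod β) {p | J p.1 (out p.1 p.2) < θ} := by
  have hmp := (measurePreserving_eval (fun _ : ι => Q) m).prod (.id β)
  refine hmp.measure_preimage (s := {p | J p.1 (out p.1 p.2) < θ})
    (measurableSet_lt ?_ measurable_const).nullMeasurableSet
  exact (measurable_score_output hJ hout).comp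
    (f := fun p : W × B => (p.1, p.1, p.2)) (by fun_prop)

lemma measure_le_score_other_le (hexp : ∀ o, ∫ w, Real.exp (J w o) ∂Q = 1) {m m' : ι}
    (hm : m' ≠ m) :
    ((Measure.pi fun _ : ι => Q).prod β) {p | θ ≤ J (p.1 m') (out (p.1 m) p.2)} ≤
      ENNReal.ofReal (Real.exp (-θ)) := by
  have hmp := (measurePreserving_prodAssoc Q Q β).comp
    ((measurePreserving_eval_pair (Q := Q) hm).prod (.id β))
  have hset : MeasurableSet {p : W × W × B | θ ≤ J p.1 (out p.2.1 p.2.2)} :=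
    measurableSet_le measurable_const (measurable_score_output hJ hout)
  refine (hmp.measure_preimage hset.nullMeasurableSet).trans_le ?_
  rw [Measure.prod_apply_symm hset]
  refine (lintegral_mono (g := fun _ => ENNReal.ofReal (Real.exp (-θ))) fun x => ?_).trans_eq
    (by simp)
  exact measure_le_le_exp_neg (hexp (out x.1 x.2))

lemma measure_thresholdDec_ne_le [Nonempty ι] (hexp : ∀ o, ∫ w, Real.exp (J w o) ∂Q = 1)
    (m : ι) :
    ((Measure.pi fun _ : ι => Q).prod β) {p | thresholdDec J θ p.1 (out (p.1 m) p.2) ≠ m} ≤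
      (Q.prod β) {p | J p.1 (out p.1 p.2) < θ} +
        (Fintype.card ι - 1 : ℕ) * ENNReal.ofReal (Real.exp (-θ)) := by
  classical
  have hunion : {p : (ι → W) × B | thresholdDec J θ p.1 (out (p.1 m) p.2) ≠ m} ⊆
      {p | J (p.1 m) (out (p.1 m) p.2) < θ} ∪
        ⋃ m' ∈ Finset.univ.erase m, {p | θ ≤ J (p.1 m') (out (p.1 m) p.2)} := by
    intro p hp
    by_contra hgood
    simp only [Set.mem_union, Set.mem_ofPred_eq, Set.mem_iUnion, not_or, not_lt, not_exists,
      Finset.mem_erase, Finset.mem_univ, and_true, not_le] at hgood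
    exact hp (thresholdDec_eq hgood.1 hgood.2)
  refine (measure_mono hunion).trans ((measure_union_le _ _).trans (add_le_add
    (measure_score_output_lt hJ hout m).le ((measure_biUnion_finset_le _ _).trans ?_)))
  refine (Finset.sum_le_card_nsmul _ _ _ fun m' hm' =>
    measure_le_score_other_le hJ hout hexp (Finset.ne_of_mem_erase hm')).trans_eq ?_
  rw [Finset.card_erase_of_mem (Finset.mem_univ m), Finset.card_univ, nsmul_eq_mul]

lemma lintegral_measure_thresholdDec_ne_le [Nonempty ι]
    (hexp : ∀ o, ∫ w, Real.exp (J w o) ∂Q = 1) (m : ι) :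
    ∫⁻ cb : ι → W, β {b | thresholdDec J θ cb (out (cb m) b) ≠ m} ∂(Measure.pi fun _ => Q) ≤
      (Q.prod β) {p | J p.1 (out p.1 p.2) < θ} +
        (Fintype.card ι - 1 : ℕ) * ENNReal.ofReal (Real.exp (-θ)) :=
  (Measure.prod_apply (measurableSet_thresholdDec_ne hJ hout m)).symm.trans_le
    (measure_thresholdDec_ne_le hJ hout hexp m)

end ThresholdDecoding

section BlockScore

variable {W B O : Type*} [MeasurableSpace W] [MeasurableSpace B] [MeasurableSpace O] {n : ℕ}

/-- The score of the codeword `w` with the observations `o`, additive over channel uses. -/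
def blockScore (j : W → O → ℝ) (w : Fin n → W) (o : Fin n → O) : ℝ := ∑ i, j (w i) (o i)

lemma measurable_blockScore {j : W → O → ℝ} (hj : Measurable (Function.uncurry j)) :
    Measurable (Function.uncurry (blockScore (n := n) j)) := by
  unfold Function.uncurry blockScore
  exact Finset.measurable_sum _ fun i _ => hj.comp
    (f := fun p : (Fin n → W) × (Fin n → O) => (p.1 i, p.2 i)) (by fun_prop)

omit [MeasurableSpace O] in
lemma integral_exp_blockScore {Q : Measure W} [SigmaFinite Q] {j : W → O → ℝ}
    (hexp : ∀ o, ∫ w, Real.exp (j w o) ∂Q = 1) (o : Fin n → O) :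
    ∫ w, Real.exp (blockScore j w o) ∂Measure.pi (fun _ => Q) = 1 := by
  simp_rw [blockScore, Real.exp_sum]
  rw [integral_fintype_prod_eq_prod (fun i w => Real.exp (j w (o i)))]
  exact Finset.prod_eq_one fun i _ => hexp (o i)

end BlockScore

section Markov

variable {α : Type*} [MeasurableSpace α] {P : Measure α} {f g : α → ℝ≥0∞} {c d p q : ℝ≥0∞}

lemma measure_lt_le_of_lintegral_le_mul (hf : AEMeasurable f P) (hle : ∫⁻ x, f x ∂P ≤ c * p) :
    P {x | p < f x} ≤ c := by
  rcases eq_or_ne p 0 with rfl | hp0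
  · have hzero : f =ᵐ[P] 0 := (lintegral_eq_zero_iff' hf).1 (by simpa using hle)
    refine (measure_eq_zero_iff_ae_notMem.2 ?_).trans_le zero_le
    filter_upwards [hzero] with x hx
    simp [hx]
  rcases eq_or_ne p ⊤ with rfl | hp
  · simp
  refine (ENNReal.mul_le_mul_iff_right hp0 hp).1 ?_
  calc p * P {x | p < f x}
      ≤ p * P {x | p ≤ f x} := mul_le_mul' le_rfl (measure_mono fun x (hx : p < f x) => hx.le)
    _ ≤ ∫⁻ x, f x ∂P := mul_meas_ge_le_lintegral₀ hf p
    _ ≤ p * c := hle.trans_eq (mul_comm c p)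

lemma exists_le_and_le_of_lintegral_le_mul [IsProbabilityMeasure P] (hf : AEMeasurable f P)
    (hg : AEMeasurable g P) (hfp : ∫⁻ x, f x ∂P ≤ c * p) (hgq : ∫⁻ x, g x ∂P ≤ d * q)
    (hcd : c + d < 1) : ∃ x, f x ≤ p ∧ g x ≤ q := by
  by_contra! hnone
  have hcover : Set.univ ⊆ {x | p < f x} ∪ {x | q < g x} := fun x _ =>
    (lt_or_ge p (f x)).imp id (hnone x)
  refine hcd.not_ge ?_
  calc 1 = P Set.univ := measure_univ.symm
    _ ≤ P {x | p < f x} + P {x | q < g x} := (measure_mono hcover).trans (measure_union_le _ _)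
    _ ≤ c + d := add_le_add (measure_lt_le_of_lintegral_le_mul hf hfp)
        (measure_lt_le_of_lintegral_le_mul hg hgq)

end Markov

/-! ### Coding for the fading channel -/

section Coding

variable {𝒮 : Type*} [MeasurableSpace 𝒮] {Pol : 𝒮 → ℝ≥0} {n M : ℕ}

lemma Code.ofReal_errorProb [NeZero M] (C : Code 𝒮 n M) (ν : Measure (ℂ × 𝒮))
    [IsFiniteMeasure ν] :
    ENNReal.ofReal (C.errorProb ν) =
      (∑ m, ((Measure.pi fun _ : Fin n => ν).prod (Measure.pi fun _ : Fin n => cscg 1))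
        {p | C.dec (C.received m p.1 p.2) ≠ m}) / M := by
  rw [Code.errorProb, ENNReal.ofReal_div_of_pos (Nat.cast_pos.2 (NeZero.pos M)),
    ENNReal.ofReal_natCast, ENNReal.ofReal_sum_of_nonneg fun _ _ => measureReal_nonneg]
  congr with m
  exact ofReal_measureReal

lemma measurePreserving_pi_prodMk {ι α β : Type*} [Fintype ι] [MeasurableSpace α]
    [MeasurableSpace β] (P : Measure α) [SigmaFinite P] (Q : Measure β) [SigmaFinite Q] :
    MeasurePreserving (fun (p : (ι → α) × (ι → β)) i => (p.1 i, p.2 i))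
      ((Measure.pi fun _ => P).prod (Measure.pi fun _ => Q)) (Measure.pi fun _ => P.prod Q) :=
  (measurePreserving_arrowProdEquivProdArrow α β ι (fun _ => P) fun _ => Q).symm

namespace ForwardModel

variable (F : ForwardModel Pol)

/-- The receiver's observations of `n` channel uses as a function of the adaptive codeword `w` and
of the states and the noise. -/
def blockObservation (w : Fin n → F.A) (b : (Fin n → ℂ × 𝒮) × (Fin n → ℂ)) : Fin n → ℂ × ℂ :=
  fun i => F.observation (w i) (b.1 i, b.2 i)

lemma measurable_blockObservation :
    Measurable (Function.uncurry (F.blockObservation (n := n))) :=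
  measurable_pi_lambda _ fun i => F.measurable_observation.comp
    (f := fun p : (Fin n → F.A) × (Fin n → ℂ × 𝒮) × (Fin n → ℂ) => (p.1 i, p.2.1 i, p.2.2 i))
    (by fun_prop)

section SymbolPower

lemma measurable_enorm_sq_X_codebook (m : Fin M) (i : Fin n) :
    Measurable fun p : (Fin M → Fin n → F.A) × (Fin n → ℂ × 𝒮) =>
      ‖F.X (p.2 i).2 (p.1 m i)‖ₑ ^ 2 :=
  (F.measurable_X.comp (f := fun p : (Fin M → Fin n → F.A) × (Fin n → ℂ × 𝒮) =>
    ((p.2 i).2, p.1 m i)) (by fun_prop)).enorm.pow_const 2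

variable {ν : Measure (ℂ × 𝒮)} [IsProbabilityMeasure ν]

lemma measurable_lintegral_enorm_sq_X_codebook (m : Fin M) (i : Fin n) :
    Measurable fun cb : Fin M → Fin n → F.A =>
      ∫⁻ σ, ‖F.X (σ i).2 (cb m i)‖ₑ ^ 2 ∂(Measure.pi fun _ => ν) :=
  (F.measurable_enorm_sq_X_codebook m i).lintegral_prod_right'

lemma lintegral_enorm_sq_X_codebook (hPol : Measurable Pol) (m : Fin M) (i : Fin n) :
    ∫⁻ cb : Fin M → Fin n → F.A, ∫⁻ σ, ‖F.X (σ i).2 (cb m i)‖ₑ ^ 2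
      ∂(Measure.pi fun _ => ν) ∂(Measure.pi fun _ => Measure.pi fun _ => F.P) =
      ∫⁻ p, Pol p.2 ∂ν := by
  have hcb := (measurePreserving_eval (fun _ : Fin n => F.P) i).comp
    (measurePreserving_eval (fun _ : Fin M => Measure.pi fun _ : Fin n => F.P) m)
  rw [lintegral_lintegral_swap (F.measurable_enorm_sq_X_codebook m i).aemeasurable,
    ← (measurePreserving_eval (fun _ : Fin n => ν) i).lintegral_comp (by fun_prop)]
  refine lintegral_congr fun σ => ?_
  have hX : Measurable (F.X (σ i).2) := F.measurable_X.of_uncurry_left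
  exact (hcb.lintegral_comp (hX.enorm.pow_const 2)).trans (F.lintegral_enorm_sq_X _)

end SymbolPower

section Codebook

variable {t : ℝ} (hm : Measurable (Function.uncurry (F.infoDensity t)))

include hm in
lemma tendsto_measure_blockScore_lt {ν : Measure (ℂ × 𝒮)} [IsProbabilityMeasure ν]
    (hint : Integrable (fun x => F.infoDensity t x.1 (F.observation x.1 x.2))
      (F.P.prod (ν.prod (cscg 1)))) {c : ℝ}
    (hc : c < ∫ x, F.infoDensity t x.1 (F.observation x.1 x.2) ∂F.P.prod (ν.prod (cscg 1))) :
    Filter.Tendsto (fun n : ℕ => ((Measure.pi fun _ : Fin n => F.P).prod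
        ((Measure.pi fun _ : Fin n => ν).prod (Measure.pi fun _ : Fin n => cscg 1)))
        {p | blockScore (F.infoDensity t) p.1 (F.blockObservation p.1 p.2) < n * c})
      Filter.atTop (nhds 0) := by
  have hmJ := F.measurable_infoDensity_observation hm
  refine (tendsto_measure_pi_sum_lt hmJ hint hc).congr fun n => ?_
  have hmp := (measurePreserving_pi_prodMk F.P (ν.prod (cscg 1))).comp
    ((MeasurePreserving.id (Measure.pi fun _ : Fin n => F.P)).prod
      (measurePreserving_pi_prodMk ν (cscg 1)))
  refine (hmp.measure_preimage (measurableSet_lt ?_ measurable_const).nullMeasurableSet).symm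
  exact Finset.measurable_sum _ fun i _ => hmJ.comp (measurable_pi_apply i)

variable [NeZero M]

/-- The code that sends the entry for the current CSIT of the adaptive codeword `cb m`, and decodes
with a threshold on the information density. -/
def codebookCode (θ : ℝ) (cb : Fin M → Fin n → F.A) : Code 𝒮 n M where
  enc i m st := F.X (st ⟨i, le_rfl⟩) (cb m i)
  measurable_enc i m := F.measurable_X.comp
    (f := fun st : {j : Fin n // j ≤ i} → 𝒮 => (st ⟨i, le_rfl⟩, cb m i)) (by fun_prop)
  dec := thresholdDec (blockScore (F.infoDensity t)) θ cb
  measurable_dec := (measurable_thresholdDec (measurable_blockScore hm)).comp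
    (f := fun o => (cb, o)) (by fun_prop)

variable {ν : Measure (ℂ × 𝒮)} [IsProbabilityMeasure ν] (θ : ℝ)

lemma ofReal_errorProb_codebookCode (cb : Fin M → Fin n → F.A) :
    ENNReal.ofReal ((F.codebookCode hm θ cb).errorProb ν) =
      (∑ m, ((Measure.pi fun _ : Fin n => ν).prod (Measure.pi fun _ : Fin n => cscg 1))
        {p | thresholdDec (blockScore (F.infoDensity t)) θ cb
          (F.blockObservation (cb m) p) ≠ m}) / M :=
  Code.ofReal_errorProb _ ν

lemma measurable_ofReal_errorProb_codebookCode :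
    Measurable fun cb : Fin M → Fin n → F.A =>
      ENNReal.ofReal ((F.codebookCode hm θ cb).errorProb ν) := by
  simp_rw [ofReal_errorProb_codebookCode]
  exact (Finset.measurable_sum _ fun m _ => measurable_measure_thresholdDec_ne
    (measurable_blockScore hm) F.measurable_blockObservation m).div_const _

lemma lintegral_errorProb_codebookCode_le (ht : 0 < t) :
    ∫⁻ cb : Fin M → Fin n → F.A, ENNReal.ofReal ((F.codebookCode hm θ cb).errorProb ν)
        ∂(Measure.pi fun _ => Measure.pi fun _ => F.P) ≤
      ((Measure.pi fun _ : Fin n => F.P).prod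
        ((Measure.pi fun _ : Fin n => ν).prod (Measure.pi fun _ : Fin n => cscg 1)))
        {p | blockScore (F.infoDensity t) p.1 (F.blockObservation p.1 p.2) < θ} +
      (M - 1 : ℕ) * ENNReal.ofReal (Real.exp (-θ)) := by
  have hmeas (m : Fin M) := measurable_measure_thresholdDec_ne (θ := θ)
    (β := (Measure.pi fun _ : Fin n => ν).prod (Measure.pi fun _ : Fin n => cscg 1))
    (measurable_blockScore hm) F.measurable_blockObservation m
  simp_rw [ofReal_errorProb_codebookCode, div_eq_mul_inv]
  rw [lintegral_mul_const _ (Finset.measurable_sum _ fun m _ => hmeas m),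
    lintegral_finsetSum _ fun m _ => hmeas m, ← div_eq_mul_inv]
  refine ENNReal.div_le_of_le_mul' ((Finset.sum_le_card_nsmul _ _ _ fun m _ =>
    lintegral_measure_thresholdDec_ne_le (measurable_blockScore hm)
      F.measurable_blockObservation (integral_exp_blockScore (F.integral_exp_infoDensity ht))
      m).trans_eq ?_)
  rw [Finset.card_univ, Fintype.card_fin, nsmul_eq_mul]

lemma measurable_avgPower_codebookCode :
    Measurable fun cb : Fin M → Fin n → F.A => (F.codebookCode hm θ cb).avgPower ν :=
  (Finset.measurable_sum _ fun m _ => Finset.measurable_sum _ fun i _ =>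
    F.measurable_lintegral_enorm_sq_X_codebook m i).div_const _

lemma lintegral_avgPower_codebookCode_le (hPol : Measurable Pol) :
    ∫⁻ cb : Fin M → Fin n → F.A, (F.codebookCode hm θ cb).avgPower ν
        ∂(Measure.pi fun _ => Measure.pi fun _ => F.P) ≤ ∫⁻ p, Pol p.2 ∂ν := by
  have hmeas (m : Fin M) (i : Fin n) :=
    F.measurable_lintegral_enorm_sq_X_codebook (ν := ν) m i
  simp only [Code.avgPower, Code.input, codebookCode, div_eq_mul_inv]
  rw [lintegral_mul_const _ (Finset.measurable_sum _ fun m _ =>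
      Finset.measurable_sum _ fun i _ => hmeas m i),
    lintegral_finsetSum _ fun m _ => Finset.measurable_sum _ fun i _ => hmeas m i,
    ← div_eq_mul_inv]
  refine ENNReal.div_le_of_le_mul' (le_of_eq ?_)
  simp_rw [lintegral_finsetSum _ fun i (_ : i ∈ Finset.univ) => hmeas _ i,
    F.lintegral_enorm_sq_X_codebook hPol]
  simp [mul_assoc]

end Codebook

end ForwardModel

/- By Markov's inequality a random codebook violates the power constraint with probability at most
`c < 1`, so the same codebook can satisfy both constraints. -/
lemma ForwardModel.eventually_exists_code (F : ForwardModel Pol) {t : ℝ} (ht : 0 < t)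
    (hm : Measurable (Function.uncurry (F.infoDensity t))) {ν : Measure (ℂ × 𝒮)}
    [IsProbabilityMeasure ν]
    (hint : Integrable (fun x => F.infoDensity t x.1 (F.observation x.1 x.2))
      (F.P.prod (ν.prod (cscg 1))))
    (hPol : Measurable Pol) {c : ℝ≥0∞} (hc : c < 1) {Pmax : ℝ≥0}
    (hpower : ∫⁻ p, Pol p.2 ∂ν ≤ c * Pmax) {r : ℝ}
    (hr : r < ∫ x, F.infoDensity t x.1 (F.observation x.1 x.2) ∂F.P.prod (ν.prod (cscg 1)))
    {ε : ℝ} (hε : 0 < ε) :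
    ∀ᶠ n : ℕ in Filter.atTop, ∃ (M : ℕ) (C : Code 𝒮 n M),
      Real.exp (n * r) ≤ M ∧ C.errorProb ν ≤ ε ∧ C.avgPower ν ≤ Pmax := by
  obtain ⟨b, hrb, hb⟩ := exists_between hr
  obtain ⟨d, hd, hcd⟩ := ENNReal.lt_iff_exists_add_pos_lt.1 hc
  have hη : 0 < (d : ℝ≥0∞) * ENNReal.ofReal ε :=
    ENNReal.mul_pos (ENNReal.coe_pos.2 hd).ne' (ENNReal.ofReal_pos.2 hε).ne'
  have hlim := (F.tendsto_measure_blockScore_lt hm hint hb).add (tendsto_floor_exp_mul_exp_neg hrb)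
  rw [add_zero] at hlim
  filter_upwards [hlim.eventually_le_const hη] with n hn
  have herror := (F.lintegral_errorProb_codebookCode_le (M := ⌊Real.exp (n * r)⌋₊ + 1) (ν := ν) hm
    (n * b) ht).trans hn
  have havg := (F.lintegral_avgPower_codebookCode_le (M := ⌊Real.exp (n * r)⌋₊ + 1) (ν := ν)
    (n := n) hm (n * b) hPol).trans hpower
  obtain ⟨cb, hcb, hcb'⟩ := exists_le_and_le_of_lintegral_le_mul
    (F.measurable_avgPower_codebookCode hm _).aemeasurable
    (F.measurable_ofReal_errorProb_codebookCode hm _).aemeasurable havg herror hcd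
  refine ⟨_, F.codebookCode hm (n * b) cb, ?_, (ENNReal.ofReal_le_ofReal_iff hε.le).1 hcb', hcb⟩
  exact_mod_cast (Nat.lt_floor_add_one _).le

lemma mul_snr_le_snr_const_mul (κ : Kernel ℂ 𝒮) (Pol : 𝒮 → ℝ≥0) {c : ℝ≥0} (hc : c ≤ 1) (h : ℂ) :
    c * snr κ Pol h ≤ snr κ (fun s => c * Pol s) h := by
  have hsqrt (s : 𝒮) : √((c * Pol s : ℝ≥0) : ℝ) = √(c : ℝ) * √(Pol s : ℝ) := by
    rw [NNReal.coe_mul, Real.sqrt_mul c.coe_nonneg]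
  have hvar := variance_nonneg (fun s => √(Pol s : ℝ)) (κ h)
  simp only [snr, hsqrt]
  rw [integral_const_mul, variance_const_mul, mul_pow, Real.sq_sqrt c.coe_nonneg, ← mul_div_assoc,
    mul_left_comm]
  gcongr
  exact mul_le_of_le_one_left hvar (by exact_mod_cast hc)

section Rates

variable {PH : Measure ℂ} {κ : Kernel ℂ 𝒮} [IsMarkovKernel κ] (hPol : Measurable Pol)
  (hH : Integrable (fun h : ℂ => Real.log (1 + ‖h‖ ^ 2)) PH)
  (hint : Integrable (fun p : ℂ × 𝒮 => (Pol p.2 : ℝ)) (PH ⊗ₘ κ))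

include hPol hH hint

lemma mul_integral_log_one_add_snr_le [SFinite PH] {c : ℝ≥0} (hc : c ≤ 1) :
    c * ∫ h, Real.log (1 + snr κ Pol h) ∂PH ≤
      ∫ h, Real.log (1 + snr κ (fun s => c * Pol s) h) ∂PH := by
  have hint' : Integrable (fun p : ℂ × 𝒮 => ((c * Pol p.2 : ℝ≥0) : ℝ)) (PH ⊗ₘ κ) :=
    hint.const_mul (c : ℝ)
  rw [← integral_const_mul]
  refine integral_mono ((integrable_log_one_add_snr hPol hH hint).const_mul _)
    (integrable_log_one_add_snr (hPol.const_mul c) hH hint') fun h => ?_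
  have hsnr : 0 ≤ c * snr κ Pol h := mul_nonneg c.coe_nonneg (snr_nonneg κ Pol h)
  refine (mul_log_one_add_le_log_one_add_mul c.coe_nonneg (by exact_mod_cast hc)
    (snr_nonneg κ Pol h)).trans (Real.log_le_log (by positivity) ?_)
  gcongr
  exact mul_snr_le_snr_const_mul κ Pol hc h

lemma eventually_exists_code_of_lt_integral_log [IsProbabilityMeasure PH] {c : ℝ≥0∞} (hc : c < 1)
    {Pmax : ℝ≥0} (hpower : ∫⁻ p, Pol p.2 ∂(PH ⊗ₘ κ) ≤ c * Pmax) {r : ℝ}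
    (hr : r < ∫ h, Real.log (1 + snr κ Pol h) ∂PH) {ε : ℝ} (hε : 0 < ε) :
    ∀ᶠ n : ℕ in Filter.atTop, ∃ (M : ℕ) (C : Code 𝒮 n M),
      Real.exp (n * r) ≤ M ∧ C.errorProb (PH ⊗ₘ κ) ≤ ε ∧ C.avgPower (PH ⊗ₘ κ) ≤ Pmax := by
  have : Nonempty 𝒮 := (κ 0).nonempty_of_neZero
  refine (optimalModel κ hPol).eventually_exists_code one_pos
    (measurable_infoDensity_optimalModel hPol)
    (integrable_infoDensity_observation_optimalModel hPol hH hint) hPol hc hpower ?_ hε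
  rwa [integral_infoDensity_observation_optimalModel hPol hH hint]

lemma isAchievableRate_integral_log [IsProbabilityMeasure PH] {Pmax : ℝ≥0}
    (hpower : ∫⁻ p, Pol p.2 ∂(PH ⊗ₘ κ) ≤ Pmax) :
    IsAchievableRate (PH ⊗ₘ κ) Pmax (∫ h, Real.log (1 + snr κ Pol h) ∂PH) := by
  intro ε hε
  have hcont : Filter.Tendsto (fun c : ℝ≥0 => c * ∫ h, Real.log (1 + snr κ Pol h) ∂PH)
      (nhdsWithin 1 (Set.Iio 1)) (nhds (∫ h, Real.log (1 + snr κ Pol h) ∂PH)) := by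
    refine tendsto_nhdsWithin_of_tendsto_nhds (Continuous.tendsto' (by fun_prop) _ _ ?_)
    rw [NNReal.coe_one, one_mul]
  have : (nhdsWithin (1 : ℝ≥0) (Set.Iio 1)).NeBot := nhdsLT_neBot_of_exists_lt ⟨0, one_pos⟩
  obtain ⟨c, hrate, hc : c < 1⟩ :=
    ((hcont.eventually_const_lt (sub_lt_self _ hε)).and self_mem_nhdsWithin).exists
  refine Filter.eventually_atTop.1 (eventually_exists_code_of_lt_integral_log (c := c)
    (hPol.const_mul c) hH (hint.const_mul (c : ℝ)) (ENNReal.coe_lt_one_iff.2 hc) ?_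
    (hrate.trans_le (mul_integral_log_one_add_snr_le hPol hH hint hc.le)) hε)
  simp_rw [ENNReal.coe_mul]
  rw [lintegral_const_mul _ (by fun_prop)]
  gcongr

end Rates

end Coding

end FadingCSIT

end

theorem mainTheorem11_general {Ω 𝒮 : Type*} [MeasurableSpace Ω] {μ : Measure Ω}
    [IsProbabilityMeasure μ] [MeasurableSpace 𝒮] {H : Ω → ℂ} {ST : Ω → 𝒮} {κ : Kernel ℂ 𝒮}
    [IsMarkovKernel κ] (hκ : HasCondDistrib ST H κ μ)
    (hH : Integrable (fun ω => Real.log (1 + ‖H ω‖ ^ 2)) μ)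
    {Pol : 𝒮 → ℝ≥0} (hPol : Measurable Pol)
    {Pmax : ℝ≥0} (hpower : ∫⁻ ω, (Pol (ST ω) : ℝ≥0∞) ∂μ ≤ Pmax) :
    Integrable (fun ω => Real.log (1 + FadingCSIT.snr κ Pol (H ω))) μ ∧
    IsGreatest (FadingCSIT.forwardGMIs (μ.map H) κ Pol)
      (∫ ω, Real.log (1 + FadingCSIT.snr κ Pol (H ω)) ∂μ) ∧
    FadingCSIT.IsAchievableRate (μ.map fun ω => (H ω, ST ω)) Pmax
      (∫ ω, Real.log (1 + FadingCSIT.snr κ Pol (H ω)) ∂μ) := by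
  have : Nonempty 𝒮 := (κ 0).nonempty_of_neZero
  have hHm : AEMeasurable H μ := hκ.aemeasurable_fst
  have : IsProbabilityMeasure (μ.map H) := Measure.isProbabilityMeasure_map hHm
  have hPH : Integrable (fun h : ℂ => Real.log (1 + ‖h‖ ^ 2)) (μ.map H) :=
    (integrable_map_measure (f := H)
      (by fun_prop : Measurable fun h : ℂ => 1 + ‖h‖ ^ 2).log.aestronglyMeasurable hHm).2 hH
  have hpower' : ∫⁻ p, Pol p.2 ∂(μ.map H ⊗ₘ κ) ≤ Pmax :=
    (hκ.lintegral_comp (f := fun p => Pol p.2) (by fun_prop)).symm.trans_le hpower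
  have hint : Integrable (fun p : ℂ × 𝒮 => (Pol p.2 : ℝ)) (μ.map H ⊗ₘ κ) :=
    FadingCSIT.integrable_coe_of_lintegral_le (hPol.comp measurable_snd) hpower'
  have hrate := FadingCSIT.integrable_log_one_add_snr hPol hPH hint
  rw [hκ.map_eq, ← integral_map hHm hrate.1]
  exact ⟨hrate.comp_aemeasurable hHm, FadingCSIT.isGreatest_forwardGMIs hPol hPH hint,
    FadingCSIT.isAchievableRate_integral_log hPol hPH hint hpower'⟩

theorem mainTheorem11 {Ω 𝒮 : Type*} [MeasurableSpace Ω] (μ : Measure Ω) [IsProbabilityMeasure μ]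
    [MeasurableSpace 𝒮] [StandardBorelSpace 𝒮] [Nonempty 𝒮]
    (H : Ω → ℂ) (hH : Measurable H) (hH2 : ∫ ω, ‖H ω‖ ^ 2 ∂μ = 1)
    (ST : Ω → 𝒮) (hST : Measurable ST)
    (Pol : 𝒮 → ℝ≥0) (hPol : Measurable Pol)
    (Pmax : ℝ≥0) (hpower : ∫⁻ ω, (Pol (ST ω) : ℝ≥0∞) ∂μ ≤ Pmax) :
    Integrable (fun ω => Real.log (1 + FadingCSIT.snr (condDistrib ST H μ) Pol (H ω))) μ ∧
    IsGreatest (FadingCSIT.forwardGMIs (μ.map H) (condDistrib ST H μ) Pol)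
      (∫ ω, Real.log (1 + FadingCSIT.snr (condDistrib ST H μ) Pol (H ω)) ∂μ) ∧
    FadingCSIT.IsAchievableRate (μ.map fun ω => (H ω, ST ω)) Pmax
      (∫ ω, Real.log (1 + FadingCSIT.snr (condDistrib ST H μ) Pol (H ω)) ∂μ) := by
  have hH2_int : Integrable (fun ω => ‖H ω‖ ^ 2) μ := .of_integral_ne_zero (hH2 ▸ one_ne_zero)
  exact mainTheorem11_general ⟨by fun_prop, (compProd_map_condDistrib hST.aemeasurable).symm⟩
    (FadingCSIT.integrable_log_one_add hH2_int fun _ => sq_nonneg _) hPol hpower
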